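/- Fix an integer $M\ge 1$ and let $\Omega_M=\{0,1,\dots,M\}^{\mathbb N}$. Sequences, and words of equal length, are ordered lexicographically ($\prec,\preceq$). For $q\in(1,M+1]$ let $\alpha(q)\in\Omega_M$ be the quasi-greedy $q$-expansion of $1$, i.e. the lexicographically largest sequence $(x_i)\in\Omega_M$ not ending with $0^\infty$ such that $\sum_{i\ge1}x_iq^{-i}=1$. For a word $c=c_1\dots c_m$ put $\overline{c}=(M-c_1)\dots(M-c_m)$ and $c^+=c_1\dots c_{m-1}(c_m+1)$. *Fundamental words and intervals.* A word $a=a_1\dots a_m$ over $\{0,\dots,M\}$ is *fundamental* if $m\ge2$ and $\overline{a_1\dots a_{m-i}}\preceq a_{i+1}\dots a_m\prec a_1\dots a_{m-i}$ for all $1\le i<m$, or if $M\ge2$, $m=1$ and $M-a_1\le a_1<M$. The set of fundamental words is $\mathcal A_M$. For $a\in\mathcal A_M$ let $J_a=[q_L(a),q_R(a)]$, where $\alpha(q_L(a))=a^\infty$ and $\alpha(q_R(a))=a^+(\overline a)^\infty$. *Composition.* For $a\in\mathcal A_M$ and $b=b_1\dots b_n\in\mathcal A_1$, the word $a\circ b$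 is the concatenation $d_1\dots d_n$ of blocks given by $d_1=a^+$ and, for $i\ge2$: if $b_{i-1}=1$, then $d_i=\overline a$ when $b_i=1$ and $d_i=\overline{a^+}$ when $b_i=0$; if $b_{i-1}=0$, then $d_i=a^+$ when $b_i=1$ and $d_i=a$ when $b_i=0$. *Irreducibility.* Let $u=k$ if $M=2k$ and $u=(k+1)k$ if $M=2k+1$. A word $a\in\mathcal A_M$ is *irreducible* if it is not of the form $c\circ d$ with $c\in\mathcal A_M$, $d\in\mathcal A_1$. For $n\ge1$ it is *$n$-irreducible* if $a=u\circ(10)^{\circ(n-1)}\circ b$ for some irreducible $b\in\mathcal A_1$, where $u\circ(10)^{\circ(n-1)}$ is obtained from $u$ by composing $n-1$ times with $10$ on the right. The interval $J_a$ is called irreducible, respectively $n$-irreducible, if $a$ is. *Special bases.* Let $\tau_i\in\{0,1\}$ be the parity of the sum of the binary digits of $i$, and for $i\ge1$ let $\lambda_i=k+\tau_i-\tau_{i-1}$ if $M=2k$ and $\lambda_i=k+\tau_i$ if $M=2k+1$. Let $q_0'=M+1$ and, for $n\ge1$, let $q_n'$ be given by $\alpha(q_n')=\lambda_1\dots\lambda_N\big(\overline{\lambda_1\dots\lambda_N}^{\,+}\big)^\infty$,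 with $N=2^{n-1}$ if $M$ is even and $N=2^n$ if $M$ is odd. Let $q_T=q_1'$, and let $q_G$ be given by $\alpha(q_G)=k^\infty$ if $M=2k$ and $\alpha(q_G)=((k+1)k)^\infty$ if $M=2k+1$. Put $I_n=(q_{n+1}',q_n']$ for $n\ge0$. **Proposition.** All the bases above ($q_G$, $q_n'$ for $n\ge1$, and $q_L(a)<q_R(a)$ for $a\in\mathcal A_M$) exist in $(1,M+1]$ and are unique, and: 1. $[q_G,q_T]$ is an irreducible interval and is not contained in $I_0=(q_T,M+1]$; every other irreducible interval is contained in $I_0$. 2. For every $n\ge1$ there is exactly one $n$-irreducible interval with right endpoint $q_{n+1}'$, and it is not contained in $I_n$; every other $n$-irreducible interval is contained in $I_n$. -/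

import Mathlib

open Set

/-! ### Sequences, words and expansions

A sequence `(x_1, x_2, …)` of digits is `s : ℕ → ℕ` with `s i = x_{i+1}`; a word is a `List ℕ`.
Sequences are compared lexicographically through Mathlib's `toLex`, words through Mathlib's
lexicographic order on lists (only words of equal length are ever compared). -/

/-- `s` is a `q`-expansion of `x` over the alphabet `{0, …, M}`: `x = ∑_{i ≥ 1} x_i / q ^ i`. -/
def IsExpansion (M : ℕ) (q x : ℝ) (s : ℕ → ℕ) : Prop :=
  (∀ i, s i ≤ M) ∧ HasSum (fun i => (s i : ℝ) / q ^ (i + 1)) x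

/-- The sequence ends with `0^∞`. -/
def EndsInZeros (s : ℕ → ℕ) : Prop := ∃ N, ∀ i, N ≤ i → s i = 0

/-- `α(q) = s`: `s` is the quasi-greedy `q`-expansion of `1`, that is, the lexicographically
largest `q`-expansion of `1` not ending with `0^∞`. -/
def IsQuasiGreedy (M : ℕ) (q : ℝ) (s : ℕ → ℕ) : Prop :=
  (IsExpansion M q 1 s ∧ ¬ EndsInZeros s) ∧
    ∀ t, IsExpansion M q 1 t → ¬ EndsInZeros t → toLex t ≤ toLex s

/-- `q` is a base in `(1, M + 1]` with `α(q) = s`. -/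
def IsBaseOf (M : ℕ) (s : ℕ → ℕ) (q : ℝ) : Prop :=
  (1 < q ∧ q ≤ (M : ℝ) + 1) ∧ IsQuasiGreedy M q s

/-- `α⁻¹(s)`, the base `q ∈ (1, M + 1]` with `α(q) = s` (arbitrary if there is none). -/
noncomputable def baseOf (M : ℕ) (s : ℕ → ℕ) : ℝ := Classical.epsilon (IsBaseOf M s)

/-- The reflection of a word: every digit `c` becomes `M - c`. -/
def wordReflect (M : ℕ) (w : List ℕ) : List ℕ := w.map (fun c => M - c)

/-- The word `w⁺`: the last digit is increased by one. -/
def wordPlus (w : List ℕ) : List ℕ := w.dropLast ++ [w.getLastD 0 + 1]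

/-- The eventually periodic sequence `u v^∞`; the second word is meant to be nonempty. -/
def wordThenPeriodic (u v : List ℕ) : ℕ → ℕ := fun i =>
  if i < u.length then u.getD i 0 else v.getD ((i - u.length) % v.length) 0

/-- The periodic sequence `w^∞`. -/
def wordPeriodic (w : List ℕ) : ℕ → ℕ := wordThenPeriodic [] w

/-! ### Fundamental words and their intervals -/

/-- The set `𝒜_M` of fundamental words over `{0, …, M}`. -/
def IsFundamental (M : ℕ) (a : List ℕ) : Prop :=
  (∀ c ∈ a, c ≤ M) ∧
    ((2 ≤ a.length ∧ ∀ i, 1 ≤ i → i < a.length →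
        wordReflect M (a.take (a.length - i)) ≤ a.drop i ∧
          a.drop i < a.take (a.length - i)) ∨
      (2 ≤ M ∧ ∃ c, a = [c] ∧ M - c ≤ c ∧ c < M))

/-- `α(q_L(a)) = a^∞`. -/
def seqL (a : List ℕ) : ℕ → ℕ := wordPeriodic a

/-- `α(q_R(a)) = a⁺ (ā)^∞`. -/
def seqR (M : ℕ) (a : List ℕ) : ℕ → ℕ := wordThenPeriodic (wordPlus a) (wordReflect M a)

/-- The left endpoint `q_L(a)` of the fundamental interval `J_a`. -/
noncomputable def qL (M : ℕ) (a : List ℕ) : ℝ := baseOf M (seqL a)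

/-- The right endpoint `q_R(a)` of the fundamental interval `J_a`. -/
noncomputable def qR (M : ℕ) (a : List ℕ) : ℝ := baseOf M (seqR M a)

/-! ### Composition of words through the two labelings of a graph -/

/-- The vertices of the graph `G`. -/
inductive GVertex
  | start
  | A
  | B

/-- The edges of the graph `G`. -/
inductive GEdge
  | e0
  | e1
  | e2
  | e3
  | e4

/-- The initial vertex of an edge. -/
def GEdge.source : GEdge → GVertex
  | .e0 => .start
  | .e1 => .A
  | .e2 => .B
  | .e3 => .B
  | .e4 => .A

/-- The terminal vertex of an edge. -/
def GEdge.target : GEdge → GVertex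
  | .e0 => .A
  | .e1 => .B
  | .e2 => .B
  | .e3 => .A
  | .e4 => .A

/-- The labeling `ℒ*` of the edges by the digits `0, 1`. -/
def GEdge.digit : GEdge → ℕ
  | .e0 => 1
  | .e1 => 0
  | .e2 => 0
  | .e3 => 1
  | .e4 => 1

/-- The labeling `ℒ_a` of the edges by blocks over `{0, …, M}`. -/
def GEdge.block (M : ℕ) (a : List ℕ) : GEdge → List ℕ
  | .e0 => wordPlus a
  | .e1 => wordReflect M (wordPlus a)
  | .e2 => a
  | .e3 => wordPlus a
  | .e4 => wordReflect M a

/-- The edge leaving `v` whose `ℒ*`-label is the binary digit `d` (the vertex `start` has a single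
outgoing edge, with label `1`). -/
def GVertex.edge : GVertex → ℕ → GEdge
  | .start, _ => .e0
  | .A, 0 => .e1
  | .A, _ + 1 => .e4
  | .B, 0 => .e2
  | .B, _ + 1 => .e3

/-- The path in `G` from `v` along which `ℒ*` reads the given binary word. -/
def gPath : GVertex → List ℕ → List GEdge
  | _, [] => []
  | v, d :: ds => v.edge d :: gPath (v.edge d).target ds

theorem GVertex.edge_source (v : GVertex) (d : ℕ) : (v.edge d).source = v := by
  cases v <;> cases d <;> rfl

/-- A binary word starting with `1` is the `ℒ*`-label of the path from `start` chosen above. -/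
theorem gPath_start_digits (b : List ℕ) (hb : ∀ d ∈ b, d ≤ 1) :
    (gPath .start (1 :: b)).map GEdge.digit = 1 :: b := by
  have key : ∀ (b : List ℕ) (v : GVertex), (∀ d ∈ b, d ≤ 1) → v ≠ .start →
      (gPath v b).map GEdge.digit = b := by
    intro b
    induction b with
    | nil => intro v _ _; rfl
    | cons d ds ih =>
      intro v h hv
      have hd : d ≤ 1 := h d (by simp)
      have ht : (v.edge d).target ≠ .start := by
        cases v <;> cases d <;> simp [GVertex.edge, GEdge.target]
      have hl : (v.edge d).digit = d := by
        interval_cases d <;> cases v <;> simp_all [GVertex.edge, GEdge.digit]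
      simp only [gPath, List.map_cons, hl]
      rw [ih _ (fun x hx => h x (by simp [hx])) ht]
  simp only [gPath, List.map_cons, GVertex.edge, GEdge.target, GEdge.digit]
  rw [key b .A hb (by simp)]

/-- The composition `a ∘ b = Φ_a⁻¹(b)` of `a ∈ 𝒜_M` and `b ∈ 𝒜_1`: the word read by `ℒ_a` along
the path from `start` on which `ℒ*` reads `b`. -/
def wordComp (M : ℕ) (a b : List ℕ) : List ℕ := (gPath .start b).flatMap (GEdge.block M a)

/-! ### Irreducible words and intervals -/

/-- The unit lift `u_M`. -/
def unitLift (M : ℕ) : List ℕ := if Even M then [M / 2] else [M / 2 + 1, M / 2]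

/-- `u_M ∘ (10)^{∘ k}`, which is `u_M` for `k = 0`. -/
def unitLiftTenPow (M : ℕ) : ℕ → List ℕ
  | 0 => unitLift M
  | k + 1 => wordComp M (unitLiftTenPow M k) [1, 0]

/-- Irreducible words of `𝒜_M`. -/
def IsIrreducibleWord (M : ℕ) (a : List ℕ) : Prop :=
  IsFundamental M a ∧
    ¬ ∃ c d, IsFundamental M c ∧ IsFundamental 1 d ∧ a = wordComp M c d

/-- `n`-irreducible words of `𝒜_M` (for `n ≥ 1`): `a = u ∘ (10)^{∘ (n - 1)} ∘ b` with `b ∈ 𝒜_1`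
irreducible. -/
def IsNIrreducibleWord (M n : ℕ) (a : List ℕ) : Prop :=
  IsFundamental M a ∧
    ∃ b, IsIrreducibleWord 1 b ∧ a = wordComp M (unitLiftTenPow M (n - 1)) b

/-- `[p, r] = J_a` for an irreducible word `a`. -/
def IsIrreducibleInterval (M : ℕ) (p r : ℝ) : Prop :=
  ∃ a, IsIrreducibleWord M a ∧ p = qL M a ∧ r = qR M a

/-- `[p, r] = J_a` for an `n`-irreducible word `a`. -/
def IsNIrreducibleInterval (M n : ℕ) (p r : ℝ) : Prop :=
  ∃ a, IsNIrreducibleWord M n a ∧ p = qL M a ∧ r = qR M a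

/-! ### The special bases -/

/-- `τ_i`, the parity of the binary digit sum of `i`. -/
def thueMorse (i : ℕ) : ℕ := (Nat.digits 2 i).sum % 2

/-- `λ_i(M)` for `i ≥ 1`. For even `M ≥ 2` the subtraction is exact. -/
def lam (M i : ℕ) : ℕ :=
  if Even M then M / 2 + thueMorse i - thueMorse (i - 1) else M / 2 + thueMorse i

/-- The word `λ_1 … λ_N`. -/
def lamWord (M N : ℕ) : List ℕ := (List.range N).map (fun i => lam M (i + 1))

/-- The sequence `α(q_n')` for `n ≥ 1`. -/
def seqPrime (M n : ℕ) : ℕ → ℕ :=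
  if Even M then
    wordThenPeriodic (lamWord M (2 ^ (n - 1)))
      (wordPlus (wordReflect M (lamWord M (2 ^ (n - 1)))))
  else
    wordThenPeriodic (lamWord M (2 ^ n)) (wordPlus (wordReflect M (lamWord M (2 ^ n))))

/-- The bases `q_0' = M + 1` and `q_n'`, `n ≥ 1`. -/
noncomputable def qPrime (M n : ℕ) : ℝ := if n = 0 then (M : ℝ) + 1 else baseOf M (seqPrime M n)

/-- The transitive base `q_T = q_1'`. -/
noncomputable def qT (M : ℕ) : ℝ := qPrime M 1

/-- The sequence `α(q_G)`: `k^∞` if `M = 2k`, and `((k+1)k)^∞` if `M = 2k+1`. -/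
def seqG (M : ℕ) : ℕ → ℕ := fun i =>
  if Even M then M / 2 else if Even i then M / 2 + 1 else M / 2

/-- The generalized golden ratio `q_G`. -/
noncomputable def qG (M : ℕ) : ℝ := baseOf M (seqG M)

/-- The intervals `I_n = (q_{n+1}', q_n']`, `n ≥ 0`. -/
def intervalI (M n : ℕ) : Set ℝ := Ioc (qPrime M (n + 1)) (qPrime M n)

/-! A digit sequence that does not end in zeros and dominates all its shifts is the quasi-greedy
expansion of 1 in exactly one base, and this base increases strictly with the sequence
(`IsAdmissibleSeq.existsUnique_base`, `IsAdmissibleSeq.baseOf_lt`). For fundamental `a`, both `a^∞`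
and `a⁺ ā^∞` are of this kind, so every claim about endpoints becomes a lexicographic comparison.

Composition extends to infinite binary sequences: `w ∘ x` is strictly increasing in `x` and
compatible with reflection. It sends `b^∞` and `b⁺ b̄^∞` to the sequences of the two endpoints of
`J_{w ∘ b}` (`seqL_wordComp`, `seqR_wordComp`), and sends `1^∞` to that of the right endpoint of
`J_w`. The doubling rule of the Thue–Morse sequence identifies `q'_{n+1}` with the right endpoint of
`J_w` for `w = u ∘ (10)^{∘ n}` (`seqPrime_succ`); in particular `[q_G, q_T] = J_u`.

The core is `eq_unitLift_or_exists_wordComp`. If `a^∞ ≤ u⁺ ū^∞`, then all shifts of `a^∞` lie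
between `u⁺ ū^∞` and its reflection. Apart from `a = u`, this forces `a^∞` to split into the blocks
of a composition `u ∘ x`, and `x` inherits fundamentality. Hence an irreducible `a ≠ u` satisfies
`u⁺ ū^∞ < a^∞`, which puts `J_a` to the right of `q_T`.

For `n`-irreducible words put `w = u ∘ (10)^{∘ (n-1)}`. For `M = 1` the unit lift is `10`, so an
irreducible binary `b ≠ 10` has `b^∞` above the right endpoint sequence of `10`. Composing with `w`
gives `q'_{n+1} < q_L(w ∘ b)`, while `b⁺ b̄^∞ ≤ 1^∞` gives `q_R(w ∘ b) ≤ q'_n`. The exceptional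
intervals end at the excluded left endpoint of `I_n`. -/

/-- The sequence with its first `k` digits removed. -/
def shiftSeq (k : ℕ) (s : ℕ → ℕ) : ℕ → ℕ := fun i => s (k + i)

/-- The reflection of a sequence. -/
def reflSeq (M : ℕ) (s : ℕ → ℕ) : ℕ → ℕ := fun i => M - s i

/-- The sequences that are quasi-greedy expansions of `1` in some base. -/
def IsAdmissibleSeq (M : ℕ) (s : ℕ → ℕ) : Prop :=
  (∀ i, s i ≤ M) ∧ ¬ EndsInZeros s ∧ ∀ n, toLex (shiftSeq n s) ≤ toLex s

theorem toLex_lt_iff {s t : ℕ → ℕ} :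
    toLex s < toLex t ↔ ∃ n, (∀ j < n, s j = t j) ∧ s n < t n := Iff.rfl

theorem shiftSeq_zero (s : ℕ → ℕ) : shiftSeq 0 s = s := by
  funext i; simp [shiftSeq]

theorem shiftSeq_shiftSeq (k l : ℕ) (s : ℕ → ℕ) :
    shiftSeq k (shiftSeq l s) = shiftSeq (l + k) s := by
  funext i; simp [shiftSeq, add_assoc]

/-! ### Admissible sequences and their bases -/

/-- The value in base `q` of a sequence of digits. -/
noncomputable def seqValue (q : ℝ) (s : ℕ → ℕ) : ℝ := ∑' i, (s i : ℝ) / q ^ (i + 1)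

section Value

variable {M : ℕ} {q : ℝ} {s t : ℕ → ℕ}

theorem hasSum_const_digits (c : ℝ) (hq : 1 < q) :
    HasSum (fun i : ℕ => c / q ^ (i + 1)) (c / (q - 1)) := by
  have hq0 : 0 < q := by linarith
  have h := (hasSum_geometric_of_lt_one (r := q⁻¹) (by positivity) (inv_lt_one_of_one_lt₀ hq)).mul_left
    (c / q)
  have hne : q - 1 ≠ 0 := by linarith
  have h1 : (fun i : ℕ => c / q ^ (i + 1)) = fun i => c / q * q⁻¹ ^ i := by
    funext i
    rw [pow_succ, inv_pow]
    field_simp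
  have h2 : c / (q - 1) = c / q * (1 - q⁻¹)⁻¹ := by
    rw [show 1 - q⁻¹ = (q - 1) / q by field_simp]
    field_simp
  rw [h1, h2]
  exact h

theorem summable_digits (hq : 1 < q) (hs : ∀ i, s i ≤ M) :
    Summable (fun i => (s i : ℝ) / q ^ (i + 1)) := by
  have hq0 : 0 < q := by linarith
  refine Summable.of_nonneg_of_le (fun i => by positivity) (fun i => ?_)
    (hasSum_const_digits (M : ℝ) hq).summable
  have : (s i : ℝ) ≤ M := by exact_mod_cast hs i
  gcongr

theorem seqValue_le (hq : 1 < q) (hs : ∀ i, s i ≤ M) : seqValue q s ≤ M / (q - 1) := by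
  have hq0 : 0 < q := by linarith
  rw [← (hasSum_const_digits (M : ℝ) hq).tsum_eq]
  refine (summable_digits hq hs).tsum_le_tsum (fun i => ?_) (hasSum_const_digits (M : ℝ) hq).summable
  have : (s i : ℝ) ≤ M := by exact_mod_cast hs i
  gcongr

theorem seqValue_eq_sum_add (hq : 1 < q) (hs : ∀ i, s i ≤ M) (n : ℕ) :
    seqValue q s = ∑ i ∈ Finset.range n, (s i : ℝ) / q ^ (i + 1) +
      seqValue q (shiftSeq n s) / q ^ n := by
  have hq0 : 0 < q := by linarith
  rw [seqValue, ← (summable_digits hq hs).sum_add_tsum_nat_add n, seqValue, ← tsum_div_const]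
  congr 2
  funext i
  simp only [shiftSeq]
  rw [div_div, ← pow_add, add_comm n i]
  congr 2
  ring

theorem seqValue_pos (hq : 1 < q) (hs : ∀ i, s i ≤ M) (h0 : ¬ EndsInZeros s) :
    0 < seqValue q s := by
  have hq0 : 0 < q := by linarith
  simp only [EndsInZeros, not_exists, not_forall] at h0
  obtain ⟨i, -, hi⟩ := h0 0
  refine (summable_digits hq hs).tsum_pos (fun i => by positivity) i ?_
  have : 0 < s i := Nat.pos_of_ne_zero hi
  positivity

theorem not_endsInZeros_shiftSeq (h0 : ¬ EndsInZeros s) (n : ℕ) : ¬ EndsInZeros (shiftSeq n s) := by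
  rintro ⟨N, hN⟩
  refine h0 ⟨n + N, fun i hi => ?_⟩
  have := hN (i - n) (by omega)
  simp only [shiftSeq] at this
  rwa [show n + (i - n) = i by omega] at this

theorem seqValue_strictAnti {q' : ℝ} (hq : 1 < q) (hqq : q < q') (hs : ∀ i, s i ≤ M)
    (h0 : ¬ EndsInZeros s) : seqValue q' s < seqValue q s := by
  have hq0 : 0 < q := by linarith
  simp only [EndsInZeros, not_exists, not_forall] at h0
  obtain ⟨i, -, hi⟩ := h0 0
  refine Summable.tsum_lt_tsum (i := i) (fun j => ?_) ?_
    (summable_digits (hq.trans hqq) hs) (summable_digits hq hs)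
  · gcongr
  · have : 0 < (s i : ℝ) := by exact_mod_cast Nat.pos_of_ne_zero hi
    gcongr

/-- Comparing two values through the first digit where the sequences differ. -/
theorem seqValue_le_of_first_difference (hq : 1 < q) (hs : ∀ i, s i ≤ M) (ht : ∀ i, t i ≤ M)
    {n : ℕ} (heq : ∀ j < n, s j = t j) (hlt : s n < t n) :
    seqValue q s + seqValue q (shiftSeq (n + 1) t) / q ^ (n + 1) ≤
      seqValue q t + (seqValue q (shiftSeq (n + 1) s) - 1) / q ^ (n + 1) := by
  have hq0 : 0 < q := by linarith
  rw [seqValue_eq_sum_add hq hs (n + 1), seqValue_eq_sum_add hq ht (n + 1),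
    Finset.sum_range_succ, Finset.sum_range_succ,
    Finset.sum_congr rfl (fun i hi => by rw [heq i (Finset.mem_range.1 hi)])]
  have h1 : ((s n : ℝ) + 1) / q ^ (n + 1) ≤ (t n : ℝ) / q ^ (n + 1) := by
    have : (s n : ℝ) + 1 ≤ t n := by exact_mod_cast hlt
    gcongr
  rw [add_div] at h1
  rw [sub_div]
  linarith

/-- Let `S` be the supremum of the values of all shifts. A smaller shift loses a full unit at its
first difference from `s`, which its tail regains up to at most `S`. This gives `S ≤ 1 + (S - 1) /
q`, impossible for `S > 1`. -/
theorem seqValue_shiftSeq_le_one (hq : 1 < q) (hs : ∀ i, s i ≤ M)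
    (hsh : ∀ n, toLex (shiftSeq n s) ≤ toLex s) (h1 : seqValue q s = 1) (n : ℕ) :
    seqValue q (shiftSeq n s) ≤ 1 := by
  have hq0 : 0 < q := by linarith
  have hbdd : BddAbove (Set.range fun n => seqValue q (shiftSeq n s)) :=
    ⟨M / (q - 1), by rintro _ ⟨n, rfl⟩; exact seqValue_le hq fun i => hs _⟩
  set S := ⨆ n, seqValue q (shiftSeq n s) with hS
  have hle : ∀ n, seqValue q (shiftSeq n s) ≤ S := fun n => le_ciSup hbdd n
  by_contra! hn
  have hS1 : 1 < S := hn.trans_le (hle n)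
  have key : ∀ n, seqValue q (shiftSeq n s) ≤ 1 + (S - 1) / q := by
    intro n
    have hpos : 0 ≤ (S - 1) / q := div_nonneg (by linarith) hq0.le
    rcases (hsh n).lt_or_eq with h | h
    · obtain ⟨j, hj, hlt⟩ := toLex_lt_iff.1 h
      have h2 := seqValue_le_of_first_difference (s := shiftSeq n s) hq (fun i => hs _) hs hj hlt
      rw [h1, shiftSeq_shiftSeq] at h2
      have h3 : 0 ≤ seqValue q (shiftSeq (j + 1) s) / q ^ (j + 1) :=
        div_nonneg (tsum_nonneg fun i => by positivity) (by positivity)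
      have h4 : (seqValue q (shiftSeq (n + (j + 1)) s) - 1) / q ^ (j + 1) ≤ (S - 1) / q ^ (j + 1) := by
        have := hle (n + (j + 1))
        gcongr
      have h5 : (S - 1) / q ^ (j + 1) ≤ (S - 1) / q := by
        apply div_le_div_of_nonneg_left (by linarith) hq0
        exact le_self_pow₀ hq.le (by omega)
      linarith
    · rw [toLex.injective h, h1]; linarith
  have h2 : S ≤ 1 + (S - 1) / q := ciSup_le key
  have h3 : (S - 1) / q < S - 1 := div_lt_self (by linarith) hq
  linarith

theorem isExpansion_iff (hq : 1 < q) (hs : ∀ i, s i ≤ M) (x : ℝ) :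
    IsExpansion M q x s ↔ seqValue q s = x :=
  ⟨fun h => h.2.tsum_eq, fun h => ⟨hs, h ▸ (summable_digits hq hs).hasSum⟩⟩

/-- Maximality is automatic: a larger expansion `t` gains a unit at the first difference, plus a
positive tail, whereas the tail of `s` is worth at most that unit. -/
theorem IsAdmissibleSeq.isBaseOf_iff (h : IsAdmissibleSeq M s) :
    IsBaseOf M s q ↔ (1 < q ∧ q ≤ (M : ℝ) + 1) ∧ seqValue q s = 1 := by
  obtain ⟨hs, h0, hsh⟩ := h
  constructor
  · rintro ⟨hq, h⟩
    exact ⟨hq, (isExpansion_iff hq.1 hs 1).1 h.1.1⟩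
  · rintro ⟨hq, h1⟩
    refine ⟨hq, ⟨(isExpansion_iff hq.1 hs 1).2 h1, h0⟩, fun t ht ht0 => ?_⟩
    by_contra! hlt
    obtain ⟨n, hn, hlt⟩ := toLex_lt_iff.1 hlt
    have h2 := seqValue_le_of_first_difference hq.1 hs ht.1 hn hlt
    have h3 := seqValue_shiftSeq_le_one hq.1 hs hsh h1 (n + 1)
    rw [h1, (isExpansion_iff hq.1 ht.1 1).1 ht] at h2
    have hq0 : 0 < q := by linarith [hq.1]
    have h4 : 0 < seqValue q (shiftSeq (n + 1) t) / q ^ (n + 1) :=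
      div_pos (seqValue_pos hq.1 (fun i => ht.1 _) (not_endsInZeros_shiftSeq ht0 _)) (by positivity)
    have h5 : (seqValue q (shiftSeq (n + 1) s) - 1) / q ^ (n + 1) ≤ 0 :=
      div_nonpos_of_nonpos_of_nonneg (by linarith) (by positivity)
    linarith

theorem exists_two_digits (h0 : ¬ EndsInZeros s) : ∃ i j, i < j ∧ s i ≠ 0 ∧ s j ≠ 0 := by
  simp only [EndsInZeros, not_exists, not_forall] at h0
  obtain ⟨i, -, hi⟩ := h0 0
  obtain ⟨j, hj, hj'⟩ := h0 (i + 1)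
  exact ⟨i, j, hj, hi, hj'⟩

/-- Two nonzero digits already contribute nearly 2 when `q` is close to 1. This supplies the left
end for the intermediate value theorem, without a limit of the whole series. -/
theorem exists_one_lt_seqValue (hs : ∀ i, s i ≤ M) (h0 : ¬ EndsInZeros s) :
    ∃ q, 1 < q ∧ q < (M : ℝ) + 1 ∧ 1 < seqValue q s := by
  obtain ⟨i, j, hij, hi, hj⟩ := exists_two_digits h0
  have hM : 1 ≤ M := (Nat.one_le_iff_ne_zero.2 hi).trans (hs i)
  have hM' : (1 : ℝ) ≤ M := by exact_mod_cast hM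
  have hcont : ContinuousAt (fun q : ℝ => 1 / q ^ (i + 1) + 1 / q ^ (j + 1)) 1 := by
    fun_prop (disch := simp)
  have hev := hcont.eventually (lt_mem_nhds (show (1 : ℝ) < 1 / 1 ^ (i + 1) + 1 / 1 ^ (j + 1) by norm_num))
  have hev2 : ∀ᶠ q : ℝ in nhdsWithin 1 (Ioi 1), q < (M : ℝ) + 1 ∧ 1 < q :=
    (eventually_nhdsWithin_of_eventually_nhds (gt_mem_nhds (by linarith))).and self_mem_nhdsWithin
  obtain ⟨q, h1, h2, h3⟩ := ((hev.filter_mono nhdsWithin_le_nhds).and hev2).exists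
  refine ⟨q, h3, h2, h1.trans_le ?_⟩
  have hq0 : 0 < q := by linarith
  have h4 := (summable_digits h3 hs).sum_le_tsum {i, j} (fun k _ => by positivity)
  rw [Finset.sum_pair hij.ne] at h4
  refine le_trans ?_ h4
  have h5 : (1 : ℝ) ≤ s i := by exact_mod_cast Nat.one_le_iff_ne_zero.2 hi
  have h6 : (1 : ℝ) ≤ s j := by exact_mod_cast Nat.one_le_iff_ne_zero.2 hj
  gcongr

theorem continuousOn_seqValue {a : ℝ} (ha : 1 < a) (hs : ∀ i, s i ≤ M) :
    ContinuousOn (fun q => seqValue q s) (Ici a) := by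
  refine continuousOn_tsum (u := fun i => (M : ℝ) / a ^ (i + 1)) (fun i => ?_)
    (hasSum_const_digits (M : ℝ) ha).summable (fun i q hq => ?_)
  · refine continuousOn_const.div (by fun_prop) (fun q hq => ?_)
    have : 0 < q := by have := mem_Ici.1 hq; linarith
    positivity
  · have hq : a ≤ q := hq
    have : 0 < q := by linarith
    rw [Real.norm_of_nonneg (by positivity)]
    have : (s i : ℝ) ≤ M := by exact_mod_cast hs i
    gcongr

theorem IsAdmissibleSeq.existsUnique_base (h : IsAdmissibleSeq M s) : ∃! q, IsBaseOf M s q := by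
  simp only [h.isBaseOf_iff]
  obtain ⟨hs, h0, hsh⟩ := h
  obtain ⟨a, ha1, haM, hlt⟩ := exists_one_lt_seqValue hs h0
  have hM : seqValue ((M : ℝ) + 1) s ≤ 1 := by
    refine (seqValue_le (by linarith) hs).trans ?_
    rw [add_sub_cancel_right]
    exact div_self_le_one _
  obtain ⟨q, hq, hq1⟩ := intermediate_value_Icc' haM.le
    ((continuousOn_seqValue ha1 hs).mono Icc_subset_Ici_self) ⟨hM, hlt.le⟩
  refine ⟨q, ⟨⟨ha1.trans_le hq.1, hq.2⟩, hq1⟩, ?_⟩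
  rintro r ⟨⟨hr1, -⟩, hr⟩
  rcases lt_trichotomy r q with hlt | rfl | hlt
  · have := seqValue_strictAnti hr1 hlt hs h0
    simp only at hq1
    linarith
  · rfl
  · have := seqValue_strictAnti (ha1.trans_le hq.1) hlt hs h0
    simp only at hq1
    linarith

theorem IsAdmissibleSeq.isBaseOf_baseOf (h : IsAdmissibleSeq M s) : IsBaseOf M s (baseOf M s) :=
  Classical.epsilon_spec h.existsUnique_base.exists

/-- In the base of `s`, the first-difference comparison makes the value of `t` exceed 1; values
decrease with the base, so `t` needs a larger one. -/
theorem IsAdmissibleSeq.baseOf_lt (hs : IsAdmissibleSeq M s) (ht : IsAdmissibleSeq M t)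
    (h : toLex s < toLex t) : baseOf M s < baseOf M t := by
  obtain ⟨⟨hp, -⟩, hps⟩ := hs.isBaseOf_iff.1 hs.isBaseOf_baseOf
  obtain ⟨⟨hr, -⟩, hrt⟩ := ht.isBaseOf_iff.1 ht.isBaseOf_baseOf
  set p := baseOf M s
  set r := baseOf M t
  have hp0 : 0 < p := by linarith
  obtain ⟨n, hn, hlt⟩ := toLex_lt_iff.1 h
  have h2 := seqValue_le_of_first_difference hp hs.1 ht.1 hn hlt
  have h3 := seqValue_shiftSeq_le_one hp hs.1 hs.2.2 hps (n + 1)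
  have h4 : 0 < seqValue p (shiftSeq (n + 1) t) / p ^ (n + 1) :=
    div_pos (seqValue_pos hp (fun i => ht.1 _) (not_endsInZeros_shiftSeq ht.2.1 _)) (by positivity)
  have h5 : (seqValue p (shiftSeq (n + 1) s) - 1) / p ^ (n + 1) ≤ 0 :=
    div_nonpos_of_nonpos_of_nonneg (by linarith) (by positivity)
  by_contra! hrp
  rcases hrp.lt_or_eq with hlt | heq
  · have := seqValue_strictAnti hr hlt ht.1 ht.2.1
    linarith
  · rw [heq] at hrt
    linarith

theorem IsAdmissibleSeq.baseOf_le (hs : IsAdmissibleSeq M s) (ht : IsAdmissibleSeq M t)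
    (h : toLex s ≤ toLex t) : baseOf M s ≤ baseOf M t := by
  rcases h.lt_or_eq with h | h
  · exact (hs.baseOf_lt ht h).le
  · rw [toLex.injective h]

end Value

/-! ### Words and their order, digit by digit -/

theorem list_lt_iff {l₁ l₂ : List ℕ} (h : l₁.length = l₂.length) :
    l₁ < l₂ ↔ ∃ j < l₁.length, (∀ l < j, l₁.getD l 0 = l₂.getD l 0) ∧
      l₁.getD j 0 < l₂.getD j 0 := by
  induction l₁ generalizing l₂ with
  | nil =>
    obtain rfl : l₂ = [] := List.length_eq_zero_iff.1 h.symm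
    simp
  | cons x xs ih =>
    obtain ⟨y, ys, rfl⟩ : ∃ y ys, l₂ = y :: ys := by
      cases l₂ with
      | nil => simp at h
      | cons y ys => exact ⟨y, ys, rfl⟩
    rw [List.cons_lt_cons_iff, ih (by simpa using h)]
    constructor
    · rintro (hlt | ⟨rfl, j, hj, heq, hlt⟩)
      · exact ⟨0, by simp, by simp, by simpa using hlt⟩
      · refine ⟨j + 1, by simpa using hj, fun l hl => ?_, by simpa using hlt⟩
        cases l with
        | zero => simp
        | succ l => simpa using heq l (by omega)
    · rintro ⟨j, hj, heq, hlt⟩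
      cases j with
      | zero => left; simpa using hlt
      | succ j =>
        right
        refine ⟨by simpa using heq 0 (by omega), j, by simpa using hj, fun l hl => ?_,
          by simpa using hlt⟩
        simpa using heq (l + 1) (by omega)

theorem list_eq_iff {l₁ l₂ : List ℕ} (h : l₁.length = l₂.length) :
    l₁ = l₂ ↔ ∀ j < l₁.length, l₁.getD j 0 = l₂.getD j 0 := by
  constructor
  · rintro rfl j _; rfl
  · intro H
    refine List.ext_getElem h fun j h1 h2 => ?_
    have := H j h1
    rwa [List.getD_eq_getElem _ _ h1, List.getD_eq_getElem _ _ h2] at this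

theorem wordPeriodic_apply (a : List ℕ) (i : ℕ) :
    wordPeriodic a i = a.getD (i % a.length) 0 := by
  simp [wordPeriodic, wordThenPeriodic]

theorem wordPeriodic_of_lt {a : List ℕ} {i : ℕ} (h : i < a.length) :
    wordPeriodic a i = a.getD i 0 := by
  rw [wordPeriodic_apply, Nat.mod_eq_of_lt h]

theorem wordPeriodic_add (a : List ℕ) (i : ℕ) :
    wordPeriodic a (i + a.length) = wordPeriodic a i := by
  simp [wordPeriodic_apply]

theorem getD_wordReflect {M : ℕ} {a : List ℕ} {i : ℕ} (h : i < a.length) :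
    (wordReflect M a).getD i 0 = M - a.getD i 0 := by
  simp [wordReflect, h]

theorem length_wordReflect (M : ℕ) (a : List ℕ) : (wordReflect M a).length = a.length := by
  simp [wordReflect]

theorem length_wordPlus {a : List ℕ} (h : 1 ≤ a.length) : (wordPlus a).length = a.length := by
  simp [wordPlus]; omega

theorem getD_wordPlus {a : List ℕ} {i : ℕ} (h : i < a.length) :
    (wordPlus a).getD i 0 = if i + 1 = a.length then a.getD i 0 + 1 else a.getD i 0 := by
  unfold wordPlus
  split_ifs with hi
  · rw [List.getD_append_right _ _ _ _ (by simp; omega)]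
    have : i = a.length - 1 := by omega
    subst this
    simp [List.getLastD_eq_getLast?, List.getLast?_eq_getElem?, List.getD_eq_getElem?_getD]
  · rw [List.getD_append _ _ _ _ (by simp; omega)]
    simp [List.getD_eq_getElem?_getD, List.getElem?_dropLast]
    rw [if_pos (by omega)]

/-! ### Fundamental words as periodic sequences -/

/-- `s = a^∞` for a fundamental word `a` of length `m`, expressed through its digits. -/
structure IsFundamentalSeq (M m : ℕ) (s : ℕ → ℕ) : Prop where
  pos : 1 ≤ m
  le : ∀ i, s i ≤ M
  periodic : ∀ i, s (i + m) = s i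
  shift_lt : ∀ i, 1 ≤ i → i < m → ∃ j, i + j < m ∧ (∀ l < j, s (i + l) = s l) ∧ s (i + j) < s j
  refl_le : ∀ i, 1 ≤ i → i < m → (∀ l, i + l < m → s (i + l) = M - s l) ∨
    ∃ j, i + j < m ∧ (∀ l < j, s (i + l) = M - s l) ∧ M - s j < s (i + j)
  refl_zero_le : M - s 0 ≤ s 0
  zero_lt : m = 1 → s 0 < M

/-- This merges the two clauses of the definition. For `m ≥ 2` the condition on the first digit
follows by comparing with the last one: `M - s 0 ≤ s (m - 1) < s 0`. -/
theorem isFundamental_iff {M : ℕ} {a : List ℕ} :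
    IsFundamental M a ↔ IsFundamentalSeq M a.length (wordPeriodic a) := by
  have hs : ∀ {i}, i < a.length → wordPeriodic a i = a.getD i 0 := wordPeriodic_of_lt
  have h1 : ∀ i, 1 ≤ i → i < a.length → (a.drop i < a.take (a.length - i) ↔
      ∃ j, i + j < a.length ∧ (∀ l < j, wordPeriodic a (i + l) = wordPeriodic a l) ∧
        wordPeriodic a (i + j) < wordPeriodic a j) := by
    intro i hi him
    rw [list_lt_iff (by simp)]
    have hd : ∀ l, i + l < a.length → (a.drop i).getD l 0 = wordPeriodic a (i + l) ∧
        (a.take (a.length - i)).getD l 0 = wordPeriodic a l := by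
      intro l hl
      rw [hs hl, hs (show l < a.length by omega)]
      constructor
      · simp [List.getD_eq_getElem?_getD]
      · simp [List.getD_eq_getElem?_getD, show l < a.length - i by omega,
          show l < a.length by omega]
    constructor
    · rintro ⟨j, hj, heq, hlt⟩
      have hj : i + j < a.length := by simp at hj; omega
      refine ⟨j, hj, fun l hl => ?_, ?_⟩
      · rw [← (hd l (by omega)).1, ← (hd l (by omega)).2, heq l hl]
      · rwa [← (hd j hj).1, ← (hd j hj).2]
    · rintro ⟨j, hj, heq, hlt⟩
      refine ⟨j, by simp; omega, fun l hl => ?_, ?_⟩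
      · rw [(hd l (by omega)).1, (hd l (by omega)).2, heq l hl]
      · rwa [(hd j hj).1, (hd j hj).2]
  have h2 : ∀ i, 1 ≤ i → i < a.length → (wordReflect M (a.take (a.length - i)) ≤ a.drop i ↔
      (∀ l, i + l < a.length → wordPeriodic a (i + l) = M - wordPeriodic a l) ∨
      ∃ j, i + j < a.length ∧ (∀ l < j, wordPeriodic a (i + l) = M - wordPeriodic a l) ∧
        M - wordPeriodic a j < wordPeriodic a (i + j)) := by
    intro i hi him
    have hlen : (wordReflect M (a.take (a.length - i))).length = a.length - i := by
      simp [length_wordReflect]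
    rw [le_iff_eq_or_lt, list_lt_iff (by simp [hlen]), list_eq_iff (by simp [hlen]), hlen]
    have hd : ∀ l, i + l < a.length → (a.drop i).getD l 0 = wordPeriodic a (i + l) ∧
        (wordReflect M (a.take (a.length - i))).getD l 0 = M - wordPeriodic a l := by
      intro l hl
      rw [hs hl, hs (show l < a.length by omega), getD_wordReflect (by simp; omega)]
      constructor
      · simp [List.getD_eq_getElem?_getD]
      · simp [List.getD_eq_getElem?_getD, show l < a.length - i by omega,
          show l < a.length by omega]
    refine or_congr ⟨fun H l hl => ?_, fun H l hl => ?_⟩ ⟨?_, ?_⟩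
    · rw [← (hd l hl).1, ← (hd l hl).2, H l (by omega)]
    · rw [(hd l (by omega)).1, (hd l (by omega)).2, H l (by omega)]
    · rintro ⟨j, hj, heq, hlt⟩
      refine ⟨j, by omega, fun l hl => ?_, ?_⟩
      · rw [← (hd l (by omega)).1, ← (hd l (by omega)).2, heq l hl]
      · rwa [← (hd j (by omega)).1, ← (hd j (by omega)).2]
    · rintro ⟨j, hj, heq, hlt⟩
      refine ⟨j, by omega, fun l hl => ?_, ?_⟩
      · rw [(hd l (by omega)).1, (hd l (by omega)).2, heq l hl]
      · rwa [(hd j (by omega)).1, (hd j (by omega)).2]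
  have hle : (∀ c ∈ a, c ≤ M) → 1 ≤ a.length → ∀ i, wordPeriodic a i ≤ M := by
    intro h hpos i
    rw [wordPeriodic_apply, List.getD_eq_getElem _ _ (Nat.mod_lt _ hpos)]
    exact h _ (List.getElem_mem _)
  constructor
  · rintro ⟨hM, ⟨hlen, H⟩ | ⟨hM2, c, rfl, hc1, hc2⟩⟩
    · have hlt := fun i hi him => (h1 i hi him).1 (H i hi him).2
      have hge := fun i hi him => (h2 i hi him).1 (H i hi him).1
      refine ⟨by omega, hle hM (by omega), wordPeriodic_add a, hlt, hge, ?_, by omega⟩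
      obtain ⟨j, hj, -, hj'⟩ := hlt (a.length - 1) (by omega) (by omega)
      obtain rfl : j = 0 := by omega
      rcases hge (a.length - 1) (by omega) (by omega) with h | ⟨j, hj, -, h⟩
      · have := h 0 (by omega); omega
      · obtain rfl : j = 0 := by omega
        omega
    · refine ⟨by simp, hle hM (by simp), wordPeriodic_add _, ?_, ?_, ?_, ?_⟩
      · intro i hi him; simp at him; omega
      · intro i hi him; simp at him; omega
      · simpa [wordPeriodic_apply] using hc1
      · simpa [wordPeriodic_apply] using hc2
  · rintro ⟨hpos, hM, -, hlt, hge, h0, h0'⟩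
    refine ⟨fun c hc => ?_, ?_⟩
    · obtain ⟨i, hi, rfl⟩ := List.getElem_of_mem hc
      have := hM i
      rwa [hs hi, List.getD_eq_getElem _ _ hi] at this
    · rcases hpos.lt_or_eq with hlen | hlen
      · left
        exact ⟨hlen, fun i hi him => ⟨(h2 i hi him).2 (hge i hi him), (h1 i hi him).2 (hlt i hi him)⟩⟩
      · right
        obtain ⟨c, rfl⟩ := List.length_eq_one_iff.1 hlen.symm
        have h0' := h0' hlen.symm
        simp only [wordPeriodic_apply] at h0 h0'
        simp at h0 h0'
        exact ⟨by omega, c, rfl, by omega, h0'⟩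

namespace IsFundamentalSeq

variable {M m : ℕ} {s : ℕ → ℕ}

theorem periodic_mul (h : IsFundamentalSeq M m s) (i k : ℕ) : s (i + m * k) = s i := by
  induction k with
  | zero => simp
  | succ k ih => rw [Nat.mul_succ, ← add_assoc, h.periodic, ih]

theorem shiftSeq_mod (h : IsFundamentalSeq M m s) (i : ℕ) : shiftSeq i s = shiftSeq (i % m) s := by
  funext l
  simp only [shiftSeq]
  conv_lhs => rw [← Nat.mod_add_div i m]
  rw [add_right_comm, h.periodic_mul]

theorem toLex_shiftSeq_lt (h : IsFundamentalSeq M m s) {i : ℕ} (hi : 1 ≤ i) (him : i < m) :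
    toLex (shiftSeq i s) < toLex s := by
  obtain ⟨j, -, hj, hlt⟩ := h.shift_lt i hi him
  exact toLex_lt_iff.2 ⟨j, hj, hlt⟩

theorem toLex_shiftSeq_le (h : IsFundamentalSeq M m s) (i : ℕ) :
    toLex (shiftSeq i s) ≤ toLex s := by
  rw [h.shiftSeq_mod]
  rcases Nat.eq_zero_or_pos (i % m) with h0 | h0
  · rw [h0, shiftSeq_zero]
  · exact (h.toLex_shiftSeq_lt h0 (Nat.mod_lt _ h.pos)).le

theorem refl_le_zero (h : IsFundamentalSeq M m s) (i : ℕ) : M - s 0 ≤ s i := by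
  have key : ∀ i < m, M - s 0 ≤ s i := by
    intro i him
    rcases Nat.eq_zero_or_pos i with rfl | hi
    · exact h.refl_zero_le
    · rcases h.refl_le i hi him with H | ⟨j, -, hj, hlt⟩
      · exact (H 0 (by omega)).ge
      · rcases Nat.eq_zero_or_pos j with rfl | hj0
        · exact hlt.le
        · exact (hj 0 hj0).ge
  have := congrFun (h.shiftSeq_mod i) 0
  simp only [shiftSeq, add_zero] at this
  rw [this]
  exact key _ (Nat.mod_lt _ h.pos)

/-- The reflection of a fundamental sequence is at most each of its shifts: otherwise the position
of the first difference could be lowered indefinitely. -/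
theorem toLex_reflSeq_le (h : IsFundamentalSeq M m s) (i : ℕ) :
    toLex (reflSeq M s) ≤ toLex (shiftSeq i s) := by
  have key : ∀ p i, i < m → (∀ j < p, s (i + j) = M - s j) → ¬ s (i + p) < M - s p := by
    intro p
    induction p using Nat.strong_induction_on with
    | _ p ih =>
      intro i him heq hlt
      rcases Nat.eq_zero_or_pos i with rfl | hi
      · rcases Nat.eq_zero_or_pos p with rfl | hp
        · have := h.refl_zero_le
          rw [zero_add] at hlt
          omega
        -- Here `s 0 = M - s 0`, so all digits, lying between `M - s 0` and `s 0`, equal `M / 2`; no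
        -- difference is possible.
        · rw [zero_add] at hlt
          have h0 := heq 0 hp
          have h1 := h.refl_le_zero p
          have h2 : s p ≤ s 0 := by
            by_contra! h3
            have := h.toLex_shiftSeq_le p
            exact this.not_gt (toLex_lt_iff.2 ⟨0, by simp, by simpa [shiftSeq] using h3⟩)
          have := h.le 0
          have := h.le p
          simp at h0
          omega
      · rcases h.refl_le i hi him with H | ⟨j, hj, hje, hjl⟩
        · have hp : m - i ≤ p := by
            by_contra! hc
            have := H p (by omega)
            omega
          -- Past the end of the word, periodicity and reflection turn the comparison into the same
          -- one at shift `m - i`, with an earlier first difference.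
          refine ih (p - (m - i)) (by omega) (m - i) (by omega) (fun j hj => ?_) ?_
          · have := heq (m - i + j) (by omega)
            rw [show i + (m - i + j) = j + m by omega, h.periodic] at this
            have := h.le j
            have := h.le (m - i + j)
            omega
          · rw [show i + p = p - (m - i) + m by omega, h.periodic] at hlt
            rw [show m - i + (p - (m - i)) = p by omega]
            have := h.le p
            omega
        · rcases lt_trichotomy j p with hjp | rfl | hjp
          · have := heq j hjp; omega
          · omega
          · have := hje p hjp; omega
  rw [h.shiftSeq_mod]
  by_contra! hlt
  obtain ⟨p, hp, hlt⟩ := toLex_lt_iff.1 hlt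
  exact key p (i % m) (Nat.mod_lt _ h.pos) hp hlt

theorem exists_lt (h : IsFundamentalSeq M m s) : s (m - 1) < M := by
  rcases h.pos.lt_or_eq with hm | hm
  · obtain ⟨j, hj, -, hlt⟩ := h.shift_lt (m - 1) (by omega) (by omega)
    have := h.le j
    obtain rfl : j = 0 := by omega
    simp at hlt
    omega
  · subst hm; exact h.zero_lt rfl

theorem zero_pos (h : IsFundamentalSeq M m s) : 0 < s 0 := by
  have := h.refl_zero_le
  rcases Nat.eq_zero_or_pos (s 0) with h0 | h0
  · have h1 := h.exists_lt
    have h2 := h.refl_le_zero (m - 1)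
    omega
  · exact h0

/-- A periodic sequence whose shifts satisfy the lexicographic inequalities comes from a
fundamental word. -/
theorem of_toLex (hm : 1 ≤ m) (hM : ∀ i, s i ≤ M) (hper : ∀ i, s (i + m) = s i)
    (hlt : ∀ i, 1 ≤ i → i < m → toLex (shiftSeq i s) < toLex s)
    (hge : ∀ i, toLex (reflSeq M s) ≤ toLex (shiftSeq i s)) (h0 : m = 1 → s 0 < M) :
    IsFundamentalSeq M m s := by
  have hle : ∀ i, toLex (shiftSeq i s) ≤ toLex s := by
    intro i
    induction i using Nat.strong_induction_on with
    | _ i ih =>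
      rcases Nat.eq_zero_or_pos i with rfl | hi
      · rw [shiftSeq_zero]
      · rcases lt_or_ge i m with him | him
        · exact (hlt i hi him).le
        · have : shiftSeq i s = shiftSeq (i - m) s := by
            funext l
            simp only [shiftSeq]
            rw [show i + l = i - m + l + m by omega, hper]
          rw [this]
          exact ih _ (by omega)
  refine ⟨hm, hM, hper, fun i hi him => ?_, fun i hi him => ?_, ?_, h0⟩
  · obtain ⟨j, hj, hjl⟩ := toLex_lt_iff.1 (hlt i hi him)
    simp only [shiftSeq] at hj hjl
    by_cases hc : i + j < m
    · exact ⟨j, hc, hj, hjl⟩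
    -- A first difference beyond the end of the word would make the shift by `m - i` larger than
    -- `s`.
    · exfalso
      refine (hle (m - i)).not_gt (toLex_lt_iff.2 ⟨j - (m - i), fun l hl => ?_, ?_⟩)
      · simp only [shiftSeq]
        rw [← hj (m - i + l) (by omega), show i + (m - i + l) = l + m by omega, hper]
      · simp only [shiftSeq]
        rw [show m - i + (j - (m - i)) = j by omega]
        rwa [show i + j = j - (m - i) + m by omega, hper] at hjl
  · rcases (hge i).lt_or_eq with h | h
    · obtain ⟨j, hj, hjl⟩ := toLex_lt_iff.1 h
      simp only [shiftSeq, reflSeq] at hj hjl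
      by_cases hc : i + j < m
      · exact Or.inr ⟨j, hc, fun l hl => (hj l hl).symm, hjl⟩
      · exact Or.inl fun l hl => (hj l (by omega)).symm
    · exact Or.inl fun l _ => (congrFun (toLex.injective h) l).symm
  · by_contra! hc
    have := hge 0
    rw [shiftSeq_zero] at this
    exact this.not_gt (toLex_lt_iff.2 ⟨0, by simp, hc⟩)

/-- If `t` begins with `w⁺` followed by the reflection of all but the last digit of `w`, then its
shifts by less than the length of `w` are smaller than `t`. -/
theorem shiftSeq_lt_of_prefix (h : IsFundamentalSeq M m s) {t : ℕ → ℕ}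
    (ht : ∀ l, l + 1 < m → t l = s l) (hm : t (m - 1) = s (m - 1) + 1)
    (ht' : ∀ l, l + 1 < m → t (m + l) = M - s l) {i : ℕ} (hi : 1 ≤ i) (him : i < m) :
    toLex (shiftSeq i t) < toLex t := by
  have hts : ∀ l < m, s l ≤ t l := by
    intro l hl
    by_cases hl' : l + 1 < m
    · exact (ht l hl').ge
    · obtain rfl : l = m - 1 := by omega
      omega
  rw [toLex_lt_iff]
  simp only [shiftSeq]
  obtain ⟨j, hj, hje, hjl⟩ := h.shift_lt i hi him
  have heq : ∀ l < j, t (i + l) = t l := by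
    intro l hl
    rw [ht l (by omega), ht (i + l) (by omega), hje l hl]
  by_cases hc : t (i + j) < t j
  · exact ⟨j, heq, hc⟩
  -- The inequality inherited from `s` can fail only when its strict digit is the last one, where
  -- the increment restores equality. Then `t` repeats its prefix of length `m - i`, and the
  -- comparison continues between reflected digits of `w` and the suffix of `t` from `m - i`.
  have hij : i + j = m - 1 := by
    by_contra hne
    rw [ht j (by omega), ht (i + j) (by omega)] at hc
    omega
  have hj' : t (i + j) = t j := by
    rw [ht j (by omega), hij, hm] at hc ⊢
    rw [hij] at hjl
    omega
  have heq' : ∀ l < m - i, t (i + l) = t l := by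
    intro l hl
    rcases lt_or_eq_of_le (show l ≤ j by omega) with hl | rfl
    · exact heq l hl
    · exact hj'
  have hcont : ∀ j', j' < i → (∀ l < j', s (m - i + l) = M - s l) → M - s j' < t (m - i + j') →
      ∃ n, (∀ l < n, t (i + l) = t l) ∧ t (i + n) < t n := by
    intro j' hj' hje' hjl'
    refine ⟨m - i + j', fun l hl => ?_, ?_⟩
    · rcases lt_or_ge l (m - i) with hl' | hl'
      · exact heq' l hl'
      · have := hje' (l - (m - i)) (by omega)
        rw [show m - i + (l - (m - i)) = l by omega] at this
        rw [show i + l = m + (l - (m - i)) by omega, ht' _ (by omega), ht l (by omega), this]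
    · rw [show i + (m - i + j') = m + j' by omega, ht' _ (by omega)]
      exact hjl'
  rcases h.refl_le (m - i) (by omega) (by omega) with H | ⟨j', hj', hje', hjl'⟩
  -- If this suffix of `w` is exactly a reflected prefix, the increment of the last digit makes the
  -- inequality strict.
  · refine hcont (i - 1) (by omega) (fun l hl => H l (by omega)) ?_
    rw [← H (i - 1) (by omega), show m - i + (i - 1) = m - 1 by omega, hm]
    omega
  · exact hcont j' (by omega) hje' (hjl'.trans_le (hts _ (by omega)))

end IsFundamentalSeq

theorem toLex_lt_of_plus {m : ℕ} {s t : ℕ → ℕ} (ht : ∀ l, l + 1 < m → t l = s l)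
    (hm : t (m - 1) = s (m - 1) + 1) : toLex s < toLex t :=
  toLex_lt_iff.2 ⟨m - 1, fun l hl => (ht l (by omega)).symm, by omega⟩

namespace IsFundamentalSeq

variable {M m : ℕ} {s : ℕ → ℕ}

theorem isAdmissibleSeq (h : IsFundamentalSeq M m s) : IsAdmissibleSeq M s := by
  refine ⟨h.le, ?_, h.toLex_shiftSeq_le⟩
  rintro ⟨N, hN⟩
  have h1 := hN (0 + m * N) (by have := Nat.mul_le_mul_right N h.pos; omega)
  rw [h.periodic_mul] at h1
  exact h.zero_pos.ne' h1

/-- If `s = a^∞`, then the sequence `t = a⁺ (ā)^∞` is admissible. -/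
theorem isAdmissibleSeq_plus {t : ℕ → ℕ} (h : IsFundamentalSeq M m s)
    (ht : ∀ l, l + 1 < m → t l = s l) (hm : t (m - 1) = s (m - 1) + 1)
    (ht' : ∀ l, t (m + l) = M - s l) : IsAdmissibleSeq M t := by
  have hlt := toLex_lt_of_plus ht hm
  refine ⟨fun i => ?_, ?_, fun i => ?_⟩
  · rcases lt_or_ge i m with hi | hi
    · by_cases hi' : i + 1 < m
      · rw [ht i hi']; exact h.le i
      · obtain rfl : i = m - 1 := by omega
        have := h.exists_lt
        omega
    · obtain ⟨l, rfl⟩ := Nat.exists_eq_add_of_le hi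
      rw [ht']; omega
  · rintro ⟨N, hN⟩
    have h1 := hN (m + (m - 1 + m * N)) (by have := Nat.mul_le_mul_right N h.pos; omega)
    rw [ht', h.periodic_mul] at h1
    have := h.exists_lt
    omega
  · rcases lt_or_ge i m with hi | hi
    · rcases Nat.eq_zero_or_pos i with rfl | hi0
      · rw [shiftSeq_zero]
      · exact (h.shiftSeq_lt_of_prefix ht hm (fun l _ => ht' l) hi0 hi).le
    · obtain ⟨l, rfl⟩ := Nat.exists_eq_add_of_le hi
      -- Shifts past `a⁺` are shifts of the reflection of `s`, hence at most `s < t`.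
      refine le_trans ?_ hlt.le
      have h1 := h.toLex_reflSeq_le l
      by_contra! hc
      obtain ⟨n, hn, hnl⟩ := toLex_lt_iff.1 hc
      refine h1.not_gt (toLex_lt_iff.2 ⟨n, fun j hj => ?_, ?_⟩)
      · have h2 := hn j hj
        simp only [shiftSeq, reflSeq] at h2 ⊢
        rw [add_assoc, ht'] at h2
        have := h.le (l + j)
        omega
      · simp only [shiftSeq, reflSeq] at hnl ⊢
        rw [add_assoc, ht'] at hnl
        have := h.le (l + n)
        omega

/-- If `s = a^∞`, then the word `a⁺` followed by its reflection is again fundamental. -/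
theorem plus_reflect {t : ℕ → ℕ} (h : IsFundamentalSeq M m s)
    (ht : ∀ l, l + 1 < m → t l = s l) (hm : t (m - 1) = s (m - 1) + 1)
    (ht' : ∀ l < m, t (m + l) = M - t l) (hper : ∀ i, t (i + 2 * m) = t i) :
    IsFundamentalSeq M (2 * m) t := by
  have hpos := h.pos
  have hlast := h.exists_lt
  have hlow : ∀ l < m, s l ≤ t l ∧ t l ≤ M := by
    intro l hl
    by_cases hl' : l + 1 < m
    · rw [ht l hl']; exact ⟨le_rfl, h.le l⟩
    · obtain rfl : l = m - 1 := by omega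
      omega
  have hle2 : ∀ i < 2 * m, t i ≤ M := by
    intro i hi
    rcases lt_or_ge i m with him | him
    · exact (hlow i him).2
    · obtain ⟨l, rfl⟩ := Nat.exists_eq_add_of_le him
      rw [ht' l (by omega)]; omega
  have hpermul : ∀ k i, t (i + 2 * m * k) = t i := by
    intro k
    induction k with
    | zero => simp
    | succ k ih => intro i; rw [Nat.mul_succ, ← add_assoc, hper, ih]
  have hmod : ∀ i, t i = t (i % (2 * m)) := by
    intro i
    conv_lhs => rw [← Nat.mod_add_div i (2 * m)]
    rw [hpermul]
  have hle : ∀ i, t i ≤ M := fun i => by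
    rw [hmod]; exact hle2 _ (Nat.mod_lt _ (by omega))
  have hrefl : ∀ i, t (m + i) = M - t i := by
    intro i
    have key : ∀ i < 2 * m, t (m + i) = M - t i := by
      intro i hi
      rcases lt_or_ge i m with him | him
      · exact ht' i him
      · obtain ⟨l, rfl⟩ := Nat.exists_eq_add_of_le him
        rw [ht' l (by omega), show m + (m + l) = l + 2 * m by ring, hper]
        have := (hlow l (by omega)).2
        omega
    rw [hmod i, ← key _ (Nat.mod_lt _ (by omega)), hmod (m + i), hmod (m + i % (2 * m))]
    simp
  have hlt : ∀ i, 1 ≤ i → i < 2 * m → toLex (shiftSeq i t) < toLex t := by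
    intro i hi him
    rcases lt_trichotomy i m with hi' | rfl | hi'
    · refine h.shiftSeq_lt_of_prefix ht hm (fun l hl => ?_) hi hi'
      rw [hrefl, ht l hl]
    · refine toLex_lt_iff.2 ⟨0, by simp, ?_⟩
      simp only [shiftSeq, hrefl]
      have h0 := h.refl_zero_le
      rcases hpos.lt_or_eq with h1 | h1
      · rw [ht 0 (by omega)]
        obtain ⟨j, hj, -, hjl⟩ := h.shift_lt (i - 1) (by omega) (by omega)
        obtain rfl : j = 0 := by omega
        have := h.refl_le_zero (i - 1)
        simp at hjl
        omega
      · subst h1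
        simp at hm
        omega
    · obtain ⟨i, rfl⟩ := Nat.exists_eq_add_of_lt hi'
      have hshift : ∀ l, shiftSeq (m + i + 1) t l = M - t (i + 1 + l) := by
        intro l
        simp only [shiftSeq]
        rw [show m + i + 1 + l = m + (i + 1 + l) by ring, hrefl]
      rw [toLex_lt_iff]
      simp only [hshift]
      rcases h.refl_le (i + 1) (by omega) (by omega) with H | ⟨j, hj, hje, hjl⟩
      · refine ⟨m - 1 - (i + 1), fun l hl => ?_, ?_⟩
        · rw [ht _ (show i + 1 + l + 1 < m by omega), ht l (by omega), H l (by omega)]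
          have := h.le l; omega
        · have := H (m - 1 - (i + 1)) (by omega)
          rw [show i + 1 + (m - 1 - (i + 1)) = m - 1 by omega] at this ⊢
          rw [hm, ht _ (by omega)]
          have := h.le (m - 1 - (i + 1))
          omega
      · refine ⟨j, fun l hl => ?_, ?_⟩
        · rw [ht _ (show i + 1 + l + 1 < m by omega), ht l (by omega), hje l hl]
          have := h.le l; omega
        · rw [ht j (by omega)]
          have := hlow (i + 1 + j) hj
          have := h.le j
          omega
  refine .of_toLex (by omega) hle hper hlt (fun i => ?_) (by omega)
  -- Translation by `m` reflects `t`, so the lower bound at shift `i` is the upper bound at shift `m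
  -- + i`.
  have h1 : toLex (shiftSeq (m + i) t) ≤ toLex t := by
    have h2 : shiftSeq (m + i) t = shiftSeq ((m + i) % (2 * m)) t := by
      funext l
      simp only [shiftSeq]
      rw [hmod (m + i + l), hmod ((m + i) % (2 * m) + l)]
      simp
    rw [h2]
    rcases Nat.eq_zero_or_pos ((m + i) % (2 * m)) with h0 | h0
    · rw [h0, shiftSeq_zero]
    · exact (hlt _ h0 (Nat.mod_lt _ (by omega))).le
  by_contra! hc
  obtain ⟨n, hn, hnl⟩ := toLex_lt_iff.1 hc
  refine h1.not_gt (toLex_lt_iff.2 ⟨n, fun j hj => ?_, ?_⟩)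
  · have h2 := hn j hj
    simp only [shiftSeq, reflSeq] at h2 ⊢
    rw [add_assoc, hrefl]
    have := hle j
    omega
  · simp only [shiftSeq, reflSeq] at hnl ⊢
    rw [add_assoc, hrefl]
    have := hle n
    omega

end IsFundamentalSeq

/-! ### Endpoint sequences and the words `u ∘ (10)^{∘ n}` -/

section Words

variable {M : ℕ} {a : List ℕ}

theorem IsFundamental.length_pos (h : IsFundamental M a) : 1 ≤ a.length :=
  (isFundamental_iff.1 h).pos

theorem seqR_of_lt {i : ℕ} (h : i < a.length) :
    seqR M a i = if i + 1 = a.length then wordPeriodic a i + 1 else wordPeriodic a i := by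
  have := length_wordPlus (show 1 ≤ a.length by omega)
  rw [seqR, wordThenPeriodic, if_pos (by omega), getD_wordPlus h, wordPeriodic_of_lt h]

theorem seqR_add (h : 1 ≤ a.length) (i : ℕ) :
    seqR M a (a.length + i) = M - wordPeriodic a i := by
  have h1 := length_wordPlus h
  rw [seqR, wordThenPeriodic, if_neg (by omega), h1, length_wordReflect,
    getD_wordReflect (Nat.mod_lt _ h), wordPeriodic_apply]
  simp

theorem IsFundamental.isAdmissibleSeq_seqL (h : IsFundamental M a) : IsAdmissibleSeq M (seqL a) :=
  (isFundamental_iff.1 h).isAdmissibleSeq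

theorem seqR_init {l : ℕ} (hl : l + 1 < a.length) : seqR M a l = wordPeriodic a l := by
  rw [seqR_of_lt (by omega), if_neg (by omega)]

theorem seqR_last (h : 1 ≤ a.length) :
    seqR M a (a.length - 1) = wordPeriodic a (a.length - 1) + 1 := by
  rw [seqR_of_lt (by omega), if_pos (by omega)]

theorem IsFundamental.isAdmissibleSeq_seqR (h : IsFundamental M a) :
    IsAdmissibleSeq M (seqR M a) :=
  (isFundamental_iff.1 h).isAdmissibleSeq_plus (fun _ hl => seqR_init hl)
    (seqR_last h.length_pos) (seqR_add h.length_pos)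

theorem IsFundamental.seqL_lt_seqR (h : IsFundamental M a) :
    toLex (seqL a) < toLex (seqR M a) :=
  toLex_lt_of_plus (fun _ hl => seqR_init hl) (seqR_last h.length_pos)

theorem wordComp_ten (M : ℕ) (w : List ℕ) :
    wordComp M w [1, 0] = wordPlus w ++ wordReflect M (wordPlus w) := by
  simp [wordComp, gPath, GVertex.edge, GEdge.target, GEdge.block]

theorem IsFundamental.wordComp_ten (h : IsFundamental M a) :
    IsFundamental M (wordComp M a [1, 0]) := by
  have hp := length_wordPlus h.length_pos
  have hpos := h.length_pos
  rw [_root_.wordComp_ten, isFundamental_iff]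
  have hlen : (wordPlus a ++ wordReflect M (wordPlus a)).length = 2 * a.length := by
    rw [List.length_append, length_wordReflect, hp]; ring
  have h1 : ∀ l < a.length, wordPeriodic (wordPlus a ++ wordReflect M (wordPlus a)) l =
      (wordPlus a).getD l 0 := by
    intro l hl
    rw [wordPeriodic_of_lt (by omega), List.getD_append _ _ _ _ (by omega)]
  rw [hlen]
  refine (isFundamental_iff.1 h).plus_reflect (fun l hl => ?_) ?_ (fun l hl => ?_) (fun i => ?_)
  · rw [h1 l (by omega), getD_wordPlus (by omega), if_neg (by omega), wordPeriodic_of_lt (by omega)]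
  · rw [h1 _ (by omega), getD_wordPlus (by omega), if_pos (by omega), wordPeriodic_of_lt (by omega)]
  · rw [h1 l hl, wordPeriodic_of_lt (by omega), List.getD_append_right _ _ _ _ (by omega), hp,
      Nat.add_sub_cancel_left, getD_wordReflect (by omega)]
  · rw [← hlen, wordPeriodic_add]

theorem isFundamental_unitLift (hM : 1 ≤ M) : IsFundamental M (unitLift M) := by
  unfold unitLift
  split_ifs with he
  · obtain ⟨k, rfl⟩ := he
    refine ⟨by simp; omega, Or.inr ⟨by omega, _, rfl, by omega, by omega⟩⟩
  · obtain ⟨k, rfl⟩ := Nat.not_even_iff_odd.1 he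
    have : (2 * k + 1) / 2 = k := by omega
    rw [this]
    refine ⟨by simp; omega, Or.inl ⟨by simp, fun i hi him => ?_⟩⟩
    obtain rfl : i = 1 := by simp at him; omega
    have : 2 * k + 1 - (k + 1) = k := by omega
    simp [wordReflect, this]
    exact List.cons_lt_cons_iff.2 (Or.inl (by omega))

theorem isFundamental_unitLiftTenPow (hM : 1 ≤ M) (n : ℕ) :
    IsFundamental M (unitLiftTenPow M n) := by
  induction n with
  | zero => exact isFundamental_unitLift hM
  | succ n ih => exact ih.wordComp_ten

theorem seqG_eq (M : ℕ) : seqG M = seqL (unitLift M) := by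
  funext i
  simp only [seqG, seqL, wordPeriodic_apply, unitLift]
  split_ifs with h1 h2
  · simp [Nat.mod_one]
  · simp [Nat.even_iff.1 h2]
  · simp [Nat.odd_iff.1 (Nat.not_even_iff_odd.1 h2)]

end Words

/-! ### The Thue–Morse sequence and the bases `q_n'` -/

section ThueMorse

theorem thueMorse_lt (i : ℕ) : thueMorse i < 2 := Nat.mod_lt _ (by norm_num)

theorem thueMorse_two_mul_add (i r : ℕ) (hr : r < 2) :
    thueMorse (r + 2 * i) = (r + thueMorse i) % 2 := by
  rcases Nat.eq_zero_or_pos (r + 2 * i) with h | h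
  · obtain rfl : r = 0 := by omega
    obtain rfl : i = 0 := by omega
    simp [thueMorse]
  · rw [thueMorse, Nat.digits_add 2 (by norm_num) r i hr (by omega)]
    simp [thueMorse]

/-- A new leading binary digit flips the parity. The induction strips the last digit, where the
recursion for `thueMorse` is available. -/
theorem thueMorse_two_pow_add (p : ℕ) {j : ℕ} (hj : j < 2 ^ p) :
    thueMorse (2 ^ p + j) = 1 - thueMorse j := by
  induction p generalizing j with
  | zero =>
    obtain rfl : j = 0 := by omega
    simp [thueMorse]
  | succ p ih =>
    have h1 := ih (show j / 2 < 2 ^ p by rw [pow_succ] at hj; omega)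
    have hr : j % 2 < 2 := Nat.mod_lt _ (by norm_num)
    have h2 := thueMorse_two_mul_add (j / 2) (j % 2) hr
    have h3 := thueMorse_two_mul_add (2 ^ p + j / 2) (j % 2) hr
    rw [show j % 2 + 2 * (2 ^ p + j / 2) = 2 ^ (p + 1) + j by rw [pow_succ]; omega, h1] at h3
    rw [Nat.mod_add_div] at h2
    have := thueMorse_lt (j / 2)
    omega

theorem thueMorse_two_pow (p : ℕ) : thueMorse (2 ^ p) = 1 := by
  have := thueMorse_two_pow_add p (j := 0) (by positivity)
  simpa [thueMorse] using this

theorem lam_two_pow_add {M : ℕ} (hM : 1 ≤ M) (p : ℕ) {j : ℕ} (hj : 1 ≤ j) (hjp : j < 2 ^ p) :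
    lam M (2 ^ p + j) = M - lam M j := by
  have h1 := thueMorse_two_pow_add p hjp
  have h2 := thueMorse_two_pow_add p (show j - 1 < 2 ^ p by omega)
  have h3 := thueMorse_lt j
  have h4 := thueMorse_lt (j - 1)
  unfold lam
  rw [show 2 ^ p + j - 1 = 2 ^ p + (j - 1) by omega, h1, h2]
  split_ifs with he
  · obtain ⟨k, rfl⟩ := he
    omega
  · obtain ⟨k, rfl⟩ := Nat.not_even_iff_odd.1 he
    omega

/-- At the end of the doubled range the index is again a power of two, so its parity stays 1 instead
of flipping; this is the extra unit. -/
theorem lam_two_pow_add_self {M : ℕ} (hM : 1 ≤ M) (p : ℕ) :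
    lam M (2 ^ p + 2 ^ p) = M - lam M (2 ^ p) + 1 := by
  have h0 : 1 ≤ 2 ^ p := Nat.one_le_two_pow
  have h1 := thueMorse_two_pow (p + 1)
  rw [pow_succ, mul_two] at h1
  have h2 := thueMorse_two_pow_add p (show 2 ^ p - 1 < 2 ^ p by omega)
  have h3 := thueMorse_two_pow p
  have h4 := thueMorse_lt (2 ^ p - 1)
  unfold lam
  rw [show 2 ^ p + 2 ^ p - 1 = 2 ^ p + (2 ^ p - 1) by omega, h1, h2, h3]
  split_ifs with he
  · obtain ⟨k, rfl⟩ := he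
    omega
  · obtain ⟨k, rfl⟩ := Nat.not_even_iff_odd.1 he
    omega

theorem length_lamWord (M N : ℕ) : (lamWord M N).length = N := by simp [lamWord]

theorem getD_lamWord {M N i : ℕ} (h : i < N) : (lamWord M N).getD i 0 = lam M (i + 1) := by
  simp [lamWord, h]

theorem lamWord_double {M : ℕ} (hM : 1 ≤ M) (p : ℕ) :
    lamWord M (2 ^ p + 2 ^ p) =
      lamWord M (2 ^ p) ++ wordPlus (wordReflect M (lamWord M (2 ^ p))) := by
  have h0 : 1 ≤ 2 ^ p := Nat.one_le_two_pow
  have hr : (wordReflect M (lamWord M (2 ^ p))).length = 2 ^ p := by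
    rw [length_wordReflect, length_lamWord]
  have hl : (wordPlus (wordReflect M (lamWord M (2 ^ p)))).length = 2 ^ p := by
    rw [length_wordPlus (by omega), hr]
  rw [list_eq_iff (by rw [List.length_append, hl, length_lamWord, length_lamWord])]
  rw [length_lamWord]
  intro j hj
  rw [getD_lamWord hj]
  rcases lt_or_ge j (2 ^ p) with hjp | hjp
  · rw [List.getD_append _ _ _ _ (by rwa [length_lamWord]), getD_lamWord hjp]
  · obtain ⟨l, rfl⟩ := Nat.exists_eq_add_of_le hjp
    rw [List.getD_append_right _ _ _ _ (by rwa [length_lamWord]), length_lamWord,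
      Nat.add_sub_cancel_left, getD_wordPlus (by omega), hr,
      getD_wordReflect (by rw [length_lamWord]; omega), getD_lamWord (by omega), add_assoc]
    split_ifs with hlast
    · rw [hlast, lam_two_pow_add_self hM]
    · rw [lam_two_pow_add hM p (by omega) (by omega)]

theorem wordPlus_append (u : List ℕ) {v : List ℕ} (hv : v ≠ []) :
    wordPlus (u ++ v) = u ++ wordPlus v := by
  simp [wordPlus, List.dropLast_append_of_ne_nil hv, List.getLastD_eq_getLast?,
    List.getLast?_append_of_ne_nil _ hv]

/-- Composing with `10` turns `w` into `w⁺` followed by its reflection, and raising the last digit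
then reproduces the doubling rule `lamWord_double`. The exponent depends on parity because `u` has
length 1 or 2. -/
theorem wordPlus_unitLiftTenPow {M : ℕ} (hM : 1 ≤ M) (n : ℕ) :
    wordPlus (unitLiftTenPow M n) = lamWord M (2 ^ (if Even M then n else n + 1)) := by
  induction n with
  | zero =>
    have h0 : thueMorse 0 = 0 := by simp [thueMorse]
    have h1 : thueMorse 1 = 1 := by simpa using thueMorse_two_pow 0
    have h2 : thueMorse 2 = 1 := by simpa using thueMorse_two_pow 1
    by_cases he : Even M
    · simp [unitLiftTenPow, unitLift, he, wordPlus, lamWord, lam, h0, h1]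
    · simp [unitLiftTenPow, unitLift, he, wordPlus, lamWord, lam, List.range_succ, h1, h2]
  | succ n ih =>
    have hpos := (isFundamental_unitLiftTenPow hM n).length_pos
    rw [unitLiftTenPow, wordComp_ten, wordPlus_append, ih]
    · rw [← lamWord_double hM]
      congr 1
      split_ifs <;> ring
    · rw [← List.length_pos_iff, length_wordReflect, length_wordPlus hpos]
      exact hpos

theorem wordPlus_wordReflect_wordPlus {M : ℕ} {a : List ℕ} (h : IsFundamental M a) :
    wordPlus (wordReflect M (wordPlus a)) = wordReflect M a := by
  have hpos := h.length_pos
  have hl := length_wordPlus hpos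
  have hlr := length_wordReflect M (wordPlus a)
  have hlast := (isFundamental_iff.1 h).exists_lt
  rw [wordPeriodic_of_lt (by omega)] at hlast
  rw [list_eq_iff (by rw [length_wordPlus (by omega), length_wordReflect, length_wordReflect, hl])]
  intro j hj
  rw [length_wordPlus (by omega)] at hj
  rw [getD_wordPlus hj, getD_wordReflect (by omega), getD_wordReflect (by omega),
    getD_wordPlus (by omega)]
  split_ifs with h1 h2 h2
  · obtain rfl : j = a.length - 1 := by omega
    omega
  · omega
  · omega
  · rfl

theorem seqPrime_succ {M : ℕ} (hM : 1 ≤ M) (n : ℕ) :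
    seqPrime M (n + 1) = seqR M (unitLiftTenPow M n) := by
  have h := wordPlus_wordReflect_wordPlus (isFundamental_unitLiftTenPow hM n)
  rw [wordPlus_unitLiftTenPow hM] at h
  rw [seqR, ← h, wordPlus_unitLiftTenPow hM]
  unfold seqPrime
  split_ifs <;> simp

end ThueMorse

/-! ### Composition with infinite binary sequences -/

/-- The digits of `w⁺`, for a word `w` of length `m` with digits `s 0, …, s (m - 1)`. -/
def plusDigit (m : ℕ) (s : ℕ → ℕ) (l : ℕ) : ℕ := if l + 1 = m then s l + 1 else s l

/-- The digits of the block that replaces the binary digit `d` after the binary digit `p`. -/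
def compBlock (M m : ℕ) (s : ℕ → ℕ) (p d l : ℕ) : ℕ :=
  if p = 0 then (if d = 0 then s l else plusDigit m s l)
  else (if d = 0 then M - plusDigit m s l else M - s l)

/-- The composition of a word of length `m` with an infinite binary sequence `x`, read after the
binary digit `p`. -/
def seqComp (M m : ℕ) (s : ℕ → ℕ) (p : ℕ) (x : ℕ → ℕ) : ℕ → ℕ := fun i =>
  compBlock M m s (if i / m = 0 then p else x (i / m - 1)) (x (i / m)) (i % m)

section SeqComp

variable {M m : ℕ} {s : ℕ → ℕ}

theorem seqComp_mul_add (p : ℕ) (x : ℕ → ℕ) (j : ℕ) {l : ℕ} (hl : l < m) :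
    seqComp M m s p x (m * j + l) = compBlock M m s (if j = 0 then p else x (j - 1)) (x j) l := by
  have h1 : (m * j + l) / m = j := by
    rw [Nat.mul_add_div (by omega), Nat.div_eq_of_lt hl, add_zero]
  have h2 : (m * j + l) % m = l := by
    rw [Nat.mul_add_mod, Nat.mod_eq_of_lt hl]
  simp only [seqComp, h1, h2]

theorem exists_eq_mul_add (hm : 1 ≤ m) (i : ℕ) : ∃ j l, l < m ∧ i = m * j + l :=
  ⟨i / m, i % m, Nat.mod_lt _ hm, (Nat.div_add_mod i m).symm⟩

theorem shiftSeq_seqComp (hm : 1 ≤ m) (p : ℕ) (x : ℕ → ℕ) (k : ℕ) :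
    shiftSeq (m * (k + 1)) (seqComp M m s p x) = seqComp M m s (x k) (shiftSeq (k + 1) x) := by
  funext i
  obtain ⟨j, l, hl, rfl⟩ := exists_eq_mul_add hm i
  rw [seqComp_mul_add _ _ _ hl, shiftSeq, ← add_assoc, ← Nat.mul_add, seqComp_mul_add _ _ _ hl,
    if_neg (by omega)]
  rcases Nat.eq_zero_or_pos j with rfl | hj
  · simp [shiftSeq]
  · rw [if_neg (by omega)]
    simp only [shiftSeq]
    rw [show k + 1 + j - 1 = k + 1 + (j - 1) by omega]

theorem plusDigit_le (h : IsFundamentalSeq M m s) {l : ℕ} (hl : l < m) : plusDigit m s l ≤ M := by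
  unfold plusDigit
  split_ifs with h1
  · obtain rfl : l = m - 1 := by omega
    exact h.exists_lt
  · exact h.le l

/-- The two blocks available after a given binary digit differ only in their last digit. With
`compBlock_one_last`, this is why composition preserves the order. -/
theorem compBlock_eq {p d d' l : ℕ} (hl : l + 1 < m) :
    compBlock M m s p d l = compBlock M m s p d' l := by
  simp only [compBlock, plusDigit, if_neg (show l + 1 ≠ m by omega), ite_self]

theorem compBlock_one_last (h : IsFundamentalSeq M m s) (p : ℕ) :
    compBlock M m s p 1 (m - 1) = compBlock M m s p 0 (m - 1) + 1 := by
  have := h.pos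
  have := h.exists_lt
  simp only [compBlock, plusDigit, if_pos (show m - 1 + 1 = m by omega), one_ne_zero, if_true,
    if_false]
  split_ifs <;> omega

theorem toLex_seqComp_lt (h : IsFundamentalSeq M m s) (p : ℕ) {x y : ℕ → ℕ} (hy : ∀ i, y i ≤ 1)
    (hxy : toLex x < toLex y) :
    toLex (seqComp M m s p x) < toLex (seqComp M m s p y) := by
  have hm := h.pos
  obtain ⟨n, hn, hlt⟩ := toLex_lt_iff.1 hxy
  have hx0 : x n = 0 := by have := hy n; omega
  have hy1 : y n = 1 := by have := hy n; omega
  have hprev : (if n = 0 then p else x (n - 1)) = (if n = 0 then p else y (n - 1)) := by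
    split_ifs
    · rfl
    · exact hn _ (by omega)
  refine toLex_lt_iff.2 ⟨m * n + (m - 1), fun i hi => ?_, ?_⟩
  · obtain ⟨j, l, hl, rfl⟩ := exists_eq_mul_add hm i
    rw [seqComp_mul_add _ _ _ hl, seqComp_mul_add _ _ _ hl]
    have hjn : j ≤ n := by
      by_contra! hc
      have := Nat.mul_le_mul_left m hc
      rw [Nat.mul_succ] at this
      omega
    rcases hjn.lt_or_eq with hjn | rfl
    · rw [hn j hjn]
      split_ifs
      · rfl
      · rw [hn _ (by omega)]
    · rw [hprev]
      exact compBlock_eq (by omega)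
  · rw [seqComp_mul_add _ _ _ (by omega), seqComp_mul_add _ _ _ (by omega), hprev, hx0, hy1,
      compBlock_one_last h]
    omega

theorem toLex_seqComp_lt_iff (h : IsFundamentalSeq M m s) (p : ℕ) {x y : ℕ → ℕ}
    (hx : ∀ i, x i ≤ 1) (hy : ∀ i, y i ≤ 1) :
    toLex (seqComp M m s p x) < toLex (seqComp M m s p y) ↔ toLex x < toLex y := by
  refine ⟨fun hlt => ?_, toLex_seqComp_lt h p hy⟩
  rcases lt_trichotomy (toLex x) (toLex y) with hc | hc | hc
  · exact hc
  · rw [toLex.injective hc] at hlt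
    exact absurd hlt (lt_irrefl _)
  · exact absurd hlt (toLex_seqComp_lt h p hx hc).not_gt

theorem toLex_seqComp_le_iff (h : IsFundamentalSeq M m s) (p : ℕ) {x y : ℕ → ℕ}
    (hx : ∀ i, x i ≤ 1) (hy : ∀ i, y i ≤ 1) :
    toLex (seqComp M m s p x) ≤ toLex (seqComp M m s p y) ↔ toLex x ≤ toLex y := by
  exact not_lt.symm.trans ((not_congr (toLex_seqComp_lt_iff h p hy hx)).trans not_lt)

theorem reflect_compBlock (h : IsFundamentalSeq M m s) {p d l : ℕ} (hp : p ≤ 1) (hd : d ≤ 1)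
    (hl : l < m) : M - compBlock M m s p d l = compBlock M m s (1 - p) (1 - d) l := by
  have h1 := plusDigit_le h hl
  have h2 := h.le l
  obtain rfl | rfl : p = 0 ∨ p = 1 := by omega
  all_goals obtain rfl | rfl : d = 0 ∨ d = 1 := by omega
  all_goals simp [compBlock]; try omega

theorem reflSeq_seqComp (h : IsFundamentalSeq M m s) {p : ℕ} {x : ℕ → ℕ} (hp : p ≤ 1)
    (hx : ∀ i, x i ≤ 1) :
    reflSeq M (seqComp M m s p x) = seqComp M m s (1 - p) (reflSeq 1 x) := by
  funext i
  obtain ⟨j, l, hl, rfl⟩ := exists_eq_mul_add h.pos i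
  rw [reflSeq, seqComp_mul_add _ _ _ hl, seqComp_mul_add _ _ _ hl]
  rw [reflect_compBlock h (by split_ifs; exacts [hp, hx _]) (hx _) hl]
  split_ifs <;> rfl

/-- A sequence with period `P` is determined by its first `P` digits. -/
theorem eq_of_periodic {P : ℕ} {s t : ℕ → ℕ} (hP : 1 ≤ P) (hs : ∀ i, s (i + P) = s i)
    (ht : ∀ i, t (i + P) = t i) (h : ∀ i < P, s i = t i) : s = t := by
  funext i
  induction i using Nat.strong_induction_on with
  | _ i ih =>
    rcases lt_or_ge i P with hi | hi
    · exact h i hi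
    · obtain ⟨l, rfl⟩ := Nat.exists_eq_add_of_le' hi
      rw [hs, ht, ih l (by omega)]

theorem seqComp_periodic (hm : 1 ≤ m) {n : ℕ} {x : ℕ → ℕ} (hn : 1 ≤ n)
    (hx : ∀ i, x (i + n) = x i) (h0 : x (n - 1) = 0) (i : ℕ) :
    seqComp M m s 0 x (i + m * n) = seqComp M m s 0 x i := by
  have := congrFun (shiftSeq_seqComp (M := M) (s := s) hm 0 x (n - 1)) i
  -- The last digit 0 of a period makes the next one start after 0, as the first does by convention.
  rw [h0, Nat.sub_add_cancel hn] at this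
  rw [add_comm]
  refine this.trans (congrFun (congrArg _ ?_) i)
  funext j
  rw [shiftSeq, add_comm, hx]

end SeqComp

/-! ### Composition of words and endpoints of composed intervals -/

section WordComp

variable {M : ℕ} {a b : List ℕ}

/-- The binary digit that `ℒ*` reads on the edges ending in a vertex other than `start`, up to the
exceptional first edge. -/
def GVertex.lastDigit : GVertex → ℕ
  | .A => 1
  | _ => 0

theorem getD_gEdge_block {M : ℕ} {a : List ℕ} (v : GVertex) (d : ℕ) (hv : v ≠ .start) {l : ℕ}
    (hl : l < a.length) :
    ((v.edge d).block M a).getD l 0 =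
      compBlock M a.length (wordPeriodic a) v.lastDigit d l := by
  have hp := length_wordPlus (show 1 ≤ a.length by omega)
  have h1 : (wordPlus a).getD l 0 = plusDigit a.length (wordPeriodic a) l := by
    rw [getD_wordPlus hl, plusDigit, wordPeriodic_of_lt hl]
  cases v with
  | start => exact absurd rfl hv
  | A =>
    cases d with
    | zero => simp [GVertex.edge, GEdge.block, GVertex.lastDigit, compBlock, getD_wordReflect (hp.symm ▸ hl), h1,
        -List.getD_eq_getElem?_getD]
    | succ d => simp [GVertex.edge, GEdge.block, GVertex.lastDigit, compBlock, getD_wordReflect hl,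
        wordPeriodic_of_lt hl, -List.getD_eq_getElem?_getD]
  | B =>
    cases d with
    | zero => simp [GVertex.edge, GEdge.block, GVertex.lastDigit, compBlock, wordPeriodic_of_lt hl,
        -List.getD_eq_getElem?_getD]
    | succ d => simp [GVertex.edge, GEdge.block, GVertex.lastDigit, compBlock, h1, -List.getD_eq_getElem?_getD]

theorem length_gEdge_block (h : 1 ≤ a.length) (e : GEdge) : (e.block M a).length = a.length := by
  cases e <;> simp [GEdge.block, length_wordReflect, length_wordPlus h]

theorem length_gPath (v : GVertex) (b : List ℕ) : (gPath v b).length = b.length := by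
  induction b generalizing v with
  | nil => rfl
  | cons d ds ih => simp [gPath, ih]

theorem length_wordComp (h : 1 ≤ a.length) :
    (wordComp M a b).length = a.length * b.length := by
  unfold wordComp
  rw [List.length_flatMap, List.map_congr_left (fun e _ => length_gEdge_block h e)]
  simp [length_gPath, mul_comm]

theorem getD_gPath_flatMap (h : 1 ≤ a.length) (b : List ℕ) (v : GVertex) (hv : v ≠ .start)
    {j l : ℕ} (hj : j < b.length) (hl : l < a.length) :
    ((gPath v b).flatMap (GEdge.block M a)).getD (a.length * j + l) 0 =
      compBlock M a.length (wordPeriodic a)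
        (if j = 0 then v.lastDigit else b.getD (j - 1) 0) (b.getD j 0) l := by
  induction b generalizing v j with
  | nil => simp at hj
  | cons d ds ih =>
    have hlen := length_gEdge_block (M := M) h (v.edge d)
    simp only [gPath, List.flatMap_cons]
    cases j with
    | zero =>
      rw [List.getD_append _ _ _ _ (by omega), mul_zero, zero_add, getD_gEdge_block v d hv hl]
      simp
    | succ j =>
      have ht : (v.edge d).target ≠ .start := by
        cases v <;> cases d <;> simp [GVertex.edge, GEdge.target]
      rw [Nat.mul_succ, List.getD_append_right _ _ _ _ (by omega), hlen,
        show a.length * j + a.length + l - a.length = a.length * j + l by omega,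
        ih _ ht (by simpa using hj)]
      rcases Nat.eq_zero_or_pos j with rfl | hj0
      · cases v with
        | start => exact absurd rfl hv
        | A => cases d <;> simp [GVertex.edge, GEdge.target, GVertex.lastDigit, compBlock]
        | B => cases d <;> simp [GVertex.edge, GEdge.target, GVertex.lastDigit, compBlock]
      · obtain ⟨j, rfl⟩ := Nat.exists_eq_add_of_lt hj0
        simp

theorem IsFundamental.digits (hb : IsFundamental 1 b) :
    wordPeriodic b 0 = 1 ∧ wordPeriodic b (b.length - 1) = 0 := by
  have hb := isFundamental_iff.1 hb
  have h1 := hb.zero_pos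
  have h2 := hb.le 0
  have h3 := hb.exists_lt
  omega

/-- With label 1, the edges from `start` and from `B` carry the same block and both lead to `A`. So
a composition may be read as starting after a virtual digit 0. -/
theorem wordComp_eq_flatMap (hb : IsFundamental 1 b) :
    wordComp M a b = (gPath .B b).flatMap (GEdge.block M a) := by
  have h1 := hb.digits.1
  have h2 := hb.length_pos
  obtain ⟨d, ds, rfl⟩ : ∃ d ds, b = d :: ds := List.exists_cons_of_length_pos h2
  simp [wordPeriodic_apply] at h1
  subst h1
  simp [wordComp, gPath, GVertex.edge, GEdge.target, GEdge.block]

theorem seqL_wordComp (ha : 1 ≤ a.length) (hb : IsFundamental 1 b) :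
    seqL (wordComp M a b) = seqComp M a.length (wordPeriodic a) 0 (seqL b) := by
  have hlen := length_wordComp (M := M) (b := b) ha
  have hbpos := hb.length_pos
  have hpos : 1 ≤ a.length * b.length := Nat.mul_pos ha hbpos
  refine eq_of_periodic hpos (fun i => ?_)
    (seqComp_periodic ha hbpos (wordPeriodic_add b) hb.digits.2) (fun i hi => ?_)
  · rw [← hlen]; exact wordPeriodic_add _ i
  · rw [seqL, wordPeriodic_of_lt (by omega), wordComp_eq_flatMap hb]
    obtain ⟨j, l, hl, rfl⟩ := exists_eq_mul_add ha i
    have hj : j < b.length := by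
      by_contra! hc
      have := Nat.mul_le_mul_left a.length hc
      omega
    rw [getD_gPath_flatMap ha b .B (by simp) hj hl, seqComp_mul_add _ _ _ hl, seqL,
      wordPeriodic_of_lt hj]
    rcases Nat.eq_zero_or_pos j with rfl | hj0
    · simp [GVertex.lastDigit]
    · rw [if_neg (by omega), if_neg (by omega), wordPeriodic_of_lt (by omega)]

theorem seqR_le_one (hb : IsFundamental 1 b) (i : ℕ) : seqR 1 b i ≤ 1 :=
  hb.isAdmissibleSeq_seqR.1 i

/-- Raising the last binary digit from 0 to 1 raises only the last letter of its block. The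
remainder is then read after 1, on the reflection of `b^∞`; by `reflSeq_seqComp` this is the
reflection of `(a ∘ b)^∞`. -/
theorem seqR_wordComp (ha : IsFundamental M a) (hb : IsFundamental 1 b) :
    seqR M (wordComp M a b) = seqComp M a.length (wordPeriodic a) 0 (seqR 1 b) := by
  have hapos := ha.length_pos
  have hbpos := hb.length_pos
  have hlen := length_wordComp (M := M) (b := b) hapos
  have hpos : 1 ≤ a.length * b.length := Nat.mul_pos hapos hbpos
  have haseq := isFundamental_iff.1 ha
  have hL := seqL_wordComp (M := M) hapos hb
  have hle : ∀ i, seqL b i ≤ 1 := hb.isAdmissibleSeq_seqL.1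
  have hRlast : seqR 1 b (b.length - 1) = 1 := by
    rw [seqR_last hbpos, hb.digits.2]
  funext i
  rcases lt_or_ge i (a.length * b.length) with hi | hi
  · rw [seqR_of_lt (by omega), hlen]
    change (if _ then seqL (wordComp M a b) i + 1 else seqL (wordComp M a b) i) = _
    rw [hL]
    obtain ⟨j, l, hl, rfl⟩ := exists_eq_mul_add hapos i
    have hj : j < b.length := by
      by_contra! hc
      have := Nat.mul_le_mul_left a.length hc
      omega
    have hmul : a.length * (j + 1) ≤ a.length * b.length := Nat.mul_le_mul_left _ hj
    rw [Nat.mul_succ] at hmul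
    rw [seqComp_mul_add _ _ _ hl, seqComp_mul_add _ _ _ hl]
    have hprev : (if j = 0 then 0 else seqR 1 b (j - 1)) = (if j = 0 then 0 else seqL b (j - 1)) := by
      split_ifs
      · rfl
      · exact seqR_init (by omega)
    rw [hprev]
    by_cases hjl : j + 1 = b.length
    · obtain rfl : j = b.length - 1 := by omega
      rw [hRlast, show seqL b (b.length - 1) = 0 from hb.digits.2]
      have hmul2 : a.length * (b.length - 1) + a.length = a.length * b.length := by
        rw [← Nat.mul_succ]; congr 1
      by_cases hll : l + 1 = a.length
      · obtain rfl : l = a.length - 1 := by omega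
        rw [if_pos (by omega), compBlock_one_last haseq]
      · rw [if_neg (by omega)]
        exact compBlock_eq (by omega)
    · have : a.length * (j + 1 + 1) ≤ a.length * b.length :=
        Nat.mul_le_mul_left _ (by omega)
      rw [Nat.mul_succ, Nat.mul_succ] at this
      rw [if_neg (by omega), show seqR 1 b j = seqL b j from seqR_init (by omega)]
  · obtain ⟨l, rfl⟩ := Nat.exists_eq_add_of_le hi
    rw [← hlen, seqR_add (by omega), hlen]
    have h1 := congrFun (shiftSeq_seqComp (M := M) (s := wordPeriodic a) hapos 0 (seqR 1 b)
      (b.length - 1)) l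
    rw [Nat.sub_add_cancel hbpos, hRlast] at h1
    refine Eq.trans ?_ h1.symm
    have h2 : shiftSeq b.length (seqR 1 b) = reflSeq 1 (seqL b) := by
      funext i
      exact seqR_add hbpos i
    rw [h2, ← congrFun (reflSeq_seqComp haseq (show 0 ≤ 1 by norm_num) hle) l, ← hL]
    rfl

theorem seqR_eq_seqComp (ha : 1 ≤ a.length) :
    seqR M a = seqComp M a.length (wordPeriodic a) 0 (fun _ => 1) := by
  funext i
  obtain ⟨j, l, hl, rfl⟩ := exists_eq_mul_add ha i
  rw [seqComp_mul_add _ _ _ hl]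
  cases j with
  | zero =>
    rw [mul_zero, zero_add, seqR_of_lt hl]
    simp [compBlock, plusDigit]
  | succ j =>
    rw [show a.length * (j + 1) + l = a.length + (a.length * j + l) by ring, seqR_add ha,
      wordPeriodic_apply, Nat.mul_add_mod, ← wordPeriodic_apply]
    simp [compBlock]

end WordComp

/-! ### Lexicographic squeezing and reflection -/

section Lex

variable {M : ℕ} {f g h : ℕ → ℕ}

theorem toLex_head_le (hfg : toLex f ≤ toLex g) : f 0 ≤ g 0 := by
  by_contra! hc
  exact hfg.not_gt (toLex_lt_iff.2 ⟨0, by simp, hc⟩)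

theorem toLex_shiftSeq_le_shiftSeq (L : ℕ) (heq : ∀ l < L, f l = g l) (hfg : toLex f ≤ toLex g) :
    toLex (shiftSeq L f) ≤ toLex (shiftSeq L g) := by
  by_contra! hc
  obtain ⟨n, hn, hlt⟩ := toLex_lt_iff.1 hc
  refine hfg.not_gt (toLex_lt_iff.2 ⟨L + n, fun j hj => ?_, hlt⟩)
  rcases lt_or_ge j L with hjL | hjL
  · exact (heq j hjL).symm
  · obtain ⟨l, rfl⟩ := Nat.exists_eq_add_of_le hjL
    exact hn l (by omega)

/-- A sequence lexicographically between two sequences shares their common prefix. -/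
theorem toLex_squeeze (hfg : toLex f ≤ toLex g) (hgh : toLex g ≤ toLex h) {K : ℕ}
    (heq : ∀ l < K, f l = h l) : (∀ l < K, g l = f l) ∧ f K ≤ g K ∧ g K ≤ h K := by
  have key : ∀ l < K, g l = f l := by
    intro l
    induction l using Nat.strong_induction_on with
    | _ l ih =>
      intro hl
      have h1 := toLex_head_le (toLex_shiftSeq_le_shiftSeq l
        (fun j hj => (ih j hj (by omega)).symm) hfg)
      have h2 := toLex_head_le (toLex_shiftSeq_le_shiftSeq l
        (fun j hj => (ih j hj (by omega)).trans (heq j (by omega))) hgh)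
      have := heq l hl
      simp only [shiftSeq, add_zero] at h1 h2
      omega
  refine ⟨key, ?_, ?_⟩
  · simpa [shiftSeq] using toLex_head_le (toLex_shiftSeq_le_shiftSeq K
      (fun j hj => (key j hj).symm) hfg)
  · simpa [shiftSeq] using toLex_head_le (toLex_shiftSeq_le_shiftSeq K
      (fun j hj => (key j hj).trans (heq j hj)) hgh)

theorem reflSeq_reflSeq (hf : ∀ i, f i ≤ M) : reflSeq M (reflSeq M f) = f := by
  funext i
  have := hf i
  simp only [reflSeq]
  omega

theorem toLex_reflSeq_le_reflSeq (hf : ∀ i, f i ≤ M) (hg : ∀ i, g i ≤ M)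
    (hfg : toLex f ≤ toLex g) : toLex (reflSeq M g) ≤ toLex (reflSeq M f) := by
  by_contra! hc
  obtain ⟨n, hn, hlt⟩ := toLex_lt_iff.1 hc
  refine hfg.not_gt (toLex_lt_iff.2 ⟨n, fun j hj => ?_, ?_⟩)
  · have := hn j hj
    have := hf j
    have := hg j
    simp only [reflSeq] at *
    omega
  · have := hf n
    have := hg n
    simp only [reflSeq] at *
    omega

theorem toLex_le_const_one (hf : ∀ i, f i ≤ 1) : toLex f ≤ toLex (fun _ : ℕ => 1) := by
  by_contra! hc
  obtain ⟨n, -, hlt⟩ := toLex_lt_iff.1 hc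
  have := hf n
  omega

/-- Putting a `1` in front of a binary sequence that is at least `f`, where `f` is not `1^∞`,
gives a sequence larger than `f`. -/
theorem toLex_lt_of_le_shiftSeq_one (hg : ∀ i, g i ≤ 1) (h0 : g 0 = 1)
    (hfg : toLex f ≤ toLex (shiftSeq 1 g)) {r : ℕ} (hr1 : ∀ j < r, f j = 1) (hr0 : f r = 0) :
    toLex f < toLex g := by
  have hsq := toLex_squeeze hfg (toLex_le_const_one fun i => hg _) hr1
  have h1 : ∀ j ≤ r, g j = 1 := by
    intro j hj
    cases j with
    | zero => exact h0
    | succ j =>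
      have := hsq.1 j (by omega)
      rw [hr1 j (by omega), shiftSeq, add_comm] at this
      exact this
  exact toLex_lt_iff.2 ⟨r, fun j hj => by rw [hr1 j hj, h1 j hj.le], by rw [hr0, h1 r le_rfl]; simp⟩

end Lex

/-! ### Recovering the block decomposition -/

section Parse

variable {M m : ℕ} {w t : ℕ → ℕ}

/-- The sequence `w⁺ (w̄)^∞`. -/
abbrev upperSeq (M m : ℕ) (w : ℕ → ℕ) : ℕ → ℕ := seqComp M m w 0 (fun _ => 1)

theorem upperSeq_le (hw : IsFundamentalSeq M m w) (i : ℕ) : upperSeq M m w i ≤ M := by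
  obtain ⟨j, l, hl, rfl⟩ := exists_eq_mul_add hw.pos i
  rw [upperSeq, seqComp_mul_add _ _ _ hl]
  have := plusDigit_le hw hl
  have := hw.le l
  simp only [compBlock]
  split_ifs <;> omega

theorem upperSeq_of_lt {l : ℕ} (hl : l < m) : upperSeq M m w l = compBlock M m w 0 1 l := by
  simpa using seqComp_mul_add (M := M) (s := w) 0 (fun _ => 1) 0 hl

theorem upperSeq_mul_succ_add (c : ℕ) {l : ℕ} (hl : l < m) :
    upperSeq M m w (m * (c + 1) + l) = compBlock M m w 1 1 l := by
  simpa using seqComp_mul_add (M := M) (s := w) 0 (fun _ => 1) (c + 1) hl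

/-- If all shifts of `t` lie between `w⁺ (w̄)^∞` and its reflection, then a common prefix of `t` and
`w⁺ (w̄)^∞` consisting of whole blocks is followed in `t` by one of two blocks. -/
theorem next_block (hw : IsFundamentalSeq M m w)
    (hU : ∀ i, toLex (shiftSeq i t) ≤ toLex (upperSeq M m w))
    (hL : ∀ i, toLex (reflSeq M (upperSeq M m w)) ≤ toLex (shiftSeq i t)) {q c : ℕ}
    (hq : ∀ l < m * (c + 1), t (q + l) = upperSeq M m w l) :
    ∃ d ≤ 1, ∀ l < m, t (q + m * (c + 1) + l) = compBlock M m w 1 d l := by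
  have hm := hw.pos
  have h1 := toLex_shiftSeq_le_shiftSeq (f := shiftSeq q t) (m * (c + 1)) hq (hU q)
  rw [shiftSeq_shiftSeq] at h1
  have hA : ∀ l < m, reflSeq M (upperSeq M m w) l = compBlock M m w 1 0 l := by
    intro l hl
    rw [reflSeq, upperSeq_of_lt hl, reflect_compBlock hw (by norm_num) le_rfl hl]
  have hC : ∀ l < m, shiftSeq (m * (c + 1)) (upperSeq M m w) l = compBlock M m w 1 1 l :=
    fun l hl => upperSeq_mul_succ_add c hl
  -- The lower bound starts with the reflection of `w⁺`, the upper one with that of `w`; these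
  -- differ by one unit in the last digit, leaving only two blocks.
  obtain ⟨h2, h3, h4⟩ := toLex_squeeze (hL _) h1 (K := m - 1) (fun l hl => by
    rw [hA l (by omega), hC l (by omega)]
    exact compBlock_eq (by omega))
  rw [hA _ (by omega)] at h3
  rw [hC _ (by omega), compBlock_one_last hw] at h4
  have h2' : ∀ d, ∀ l < m - 1, t (q + m * (c + 1) + l) = compBlock M m w 1 d l := by
    intro d l hl
    have := h2 l hl
    rw [hA l (by omega)] at this
    exact this.trans (compBlock_eq (by omega))
  have hsplit : ∀ d, t (q + m * (c + 1) + (m - 1)) = compBlock M m w 1 d (m - 1) →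
      ∀ l < m, t (q + m * (c + 1) + l) = compBlock M m w 1 d l := by
    intro d hd l hl
    rcases lt_or_eq_of_le (show l ≤ m - 1 by omega) with hl | rfl
    · exact h2' d l hl
    · exact hd
  simp only [shiftSeq] at h3 h4
  rcases h3.lt_or_eq with h3 | h3
  · refine ⟨1, le_rfl, hsplit 1 ?_⟩
    rw [compBlock_one_last hw]
    omega
  · exact ⟨0, by norm_num, hsplit 0 h3.symm⟩

/-- The binary sequence read off the block decomposition of `t`. -/
noncomputable def parseDigit (M m : ℕ) (w t : ℕ → ℕ) : ℕ → ℕ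
  | 0 => 1
  | j + 1 => if t (m * (j + 1) + (m - 1)) = compBlock M m w (parseDigit M m w t j) 1 (m - 1)
      then 1 else 0

theorem parseDigit_le (j : ℕ) : parseDigit M m w t j ≤ 1 := by
  cases j with
  | zero => exact le_rfl
  | succ j => rw [parseDigit]; split_ifs <;> simp

theorem parseDigit_succ_eq (hw : IsFundamentalSeq M m w) {j d : ℕ} (hd : d ≤ 1)
    (h : t (m * (j + 1) + (m - 1)) = compBlock M m w (parseDigit M m w t j) d (m - 1)) :
    parseDigit M m w t (j + 1) = d := by
  rw [parseDigit, h, compBlock_one_last hw]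
  obtain rfl | rfl : d = 0 ∨ d = 1 := by omega
  · simp
  · rw [compBlock_one_last hw]; simp

/-- The invariant: up to the end of block `j`, either `t` (if `x j = 1`) or its reflection (if `x j
= 0`) has just run through `w⁺ w̄ ⋯ w̄` from some position `q`. `next_block` offers two
continuations: one prolongs this run, the other starts a new run of the reflected sequence. The
hypotheses are symmetric under reflection, so both cases use the same argument. -/
theorem exists_eq_seqComp (hw : IsFundamentalSeq M m w) (ht : ∀ i, t i ≤ M)
    (hU : ∀ i, toLex (shiftSeq i t) ≤ toLex (upperSeq M m w))
    (hL : ∀ i, toLex (reflSeq M (upperSeq M m w)) ≤ toLex (shiftSeq i t))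
    (h0 : ∀ l < m, t l = upperSeq M m w l) :
    ∃ x : ℕ → ℕ, x 0 = 1 ∧ (∀ i, x i ≤ 1) ∧ t = seqComp M m w 0 x := by
  have hm := hw.pos
  have hU' : ∀ i, toLex (shiftSeq i (reflSeq M t)) ≤ toLex (upperSeq M m w) := by
    intro i
    have := toLex_reflSeq_le_reflSeq (M := M) (f := reflSeq M (upperSeq M m w)) (g := shiftSeq i t)
      (fun _ => Nat.sub_le _ _) (fun _ => ht _) (hL i)
    rwa [reflSeq_reflSeq (upperSeq_le hw)] at this
  have hL' : ∀ i, toLex (reflSeq M (upperSeq M m w)) ≤ toLex (shiftSeq i (reflSeq M t)) :=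
    fun i => toLex_reflSeq_le_reflSeq (fun _ => ht _) (upperSeq_le hw) (hU i)
  set x := parseDigit M m w t with hx
  have hx1 : ∀ i, x i ≤ 1 := parseDigit_le
  have key : ∀ j, (∀ l < m, t (m * j + l) = compBlock M m w (if j = 0 then 0 else x (j - 1)) (x j) l) ∧
      ∃ q c, q + m * (c + 1) = m * (j + 1) ∧
        ((x j = 1 ∧ ∀ l < m * (c + 1), t (q + l) = upperSeq M m w l) ∨
          (x j = 0 ∧ ∀ l < m * (c + 1), reflSeq M t (q + l) = upperSeq M m w l)) := by
    intro j
    induction j with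
    | zero =>
      refine ⟨fun l hl => ?_, 0, 0, by simp, Or.inl ⟨rfl, fun l hl => ?_⟩⟩
      · rw [mul_zero, zero_add, h0 l hl, upperSeq_of_lt hl]; rfl
      · rw [zero_add, h0 l (by simpa using hl)]
    | succ j ih =>
      obtain ⟨-, q, c, hqc, hcase⟩ := ih
      have hext : ∀ (t' : ℕ → ℕ), (∀ l < m * (c + 1), t' (q + l) = upperSeq M m w l) →
          (∀ l < m, t' (m * (j + 1) + l) = compBlock M m w 1 1 l) →
          ∀ l < m * (c + 1 + 1), t' (q + l) = upperSeq M m w l := by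
        intro t' h1 h2 l hl
        rcases lt_or_ge l (m * (c + 1)) with hlc | hlc
        · exact h1 l hlc
        · obtain ⟨l, rfl⟩ := Nat.exists_eq_add_of_le hlc
          rw [Nat.mul_succ m (c + 1)] at hl
          rw [← add_assoc, hqc, h2 l (by omega), upperSeq_mul_succ_add c (by omega)]
      have hend : q + m * (c + 1 + 1) = m * (j + 1 + 1) := by
        rw [Nat.mul_succ m (c + 1), Nat.mul_succ m (j + 1)]; omega
      simp only [Nat.add_eq_zero_iff, one_ne_zero, and_false, if_false, Nat.add_sub_cancel]
      rcases hcase with ⟨hxj, hpre⟩ | ⟨hxj, hpre⟩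
      · obtain ⟨d, hd, hblock⟩ := next_block hw hU hL hpre
        rw [hqc] at hblock
        have hxd : x (j + 1) = d := parseDigit_succ_eq hw hd (by
          rw [hblock _ (by omega), ← hx, hxj])
        refine ⟨fun l hl => by rw [hblock l hl, hxj, hxd], ?_⟩
        obtain rfl | rfl : d = 1 ∨ d = 0 := by omega
        · exact ⟨q, c + 1, hend, Or.inl ⟨hxd, hext t hpre hblock⟩⟩
        · refine ⟨m * (j + 1), 0, by ring, Or.inr ⟨hxd, fun l hl => ?_⟩⟩
          have hl : l < m := by simpa using hl
          rw [reflSeq, hblock l hl, reflect_compBlock hw le_rfl (by norm_num) hl,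
            upperSeq_of_lt hl]
      · obtain ⟨d, hd, hblock⟩ := next_block hw hU' hL' hpre
        rw [hqc] at hblock
        have hblock' : ∀ l < m, t (m * (j + 1) + l) = compBlock M m w 0 (1 - d) l := by
          intro l hl
          have h1 := hblock l hl
          have h2 := reflect_compBlock hw (p := 1) le_rfl hd hl
          have h3 := ht (m * (j + 1) + l)
          simp only [reflSeq] at h1
          simp only [Nat.sub_self] at h2
          omega
        have hxd : x (j + 1) = 1 - d := parseDigit_succ_eq hw (by omega) (by
          rw [hblock' _ (by omega), ← hx, hxj])
        refine ⟨fun l hl => by rw [hblock' l hl, hxj, hxd], ?_⟩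
        obtain rfl | rfl : d = 1 ∨ d = 0 := by omega
        · exact ⟨q, c + 1, hend, Or.inr ⟨hxd, hext _ hpre hblock⟩⟩
        · refine ⟨m * (j + 1), 0, by ring, Or.inl ⟨hxd, fun l hl => ?_⟩⟩
          have hl : l < m := by simpa using hl
          rw [hblock' l hl, upperSeq_of_lt hl]
  refine ⟨x, rfl, hx1, funext fun i => ?_⟩
  obtain ⟨j, l, hl, rfl⟩ := exists_eq_mul_add hm i
  rw [(key j).1 l hl, seqComp_mul_add _ _ _ hl]

theorem IsFundamentalSeq.refl_lt_plusDigit (hw : IsFundamentalSeq M m w) :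
    M - w 0 < plusDigit m w 0 := by
  have h0 := hw.refl_zero_le
  rcases hw.pos.lt_or_eq with h1 | h1
  · obtain ⟨j, hj, -, hjl⟩ := hw.shift_lt (m - 1) (by omega) (by omega)
    obtain rfl : j = 0 := by omega
    have := hw.refl_le_zero (m - 1)
    simp only [plusDigit, if_neg (show 0 + 1 ≠ m by omega)]
    simp at hjl
    omega
  · subst h1
    simp only [plusDigit, zero_add, if_true]
    omega

theorem seqComp_injective (hw : IsFundamentalSeq M m w) (p : ℕ) {x y : ℕ → ℕ}
    (hx : ∀ i, x i ≤ 1) (hy : ∀ i, y i ≤ 1) (h : seqComp M m w p x = seqComp M m w p y) :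
    x = y := by
  apply toLex.injective
  apply le_antisymm
  · exact (toLex_seqComp_le_iff hw p hx hy).1 (by rw [h])
  · exact (toLex_seqComp_le_iff hw p hy hx).1 (by rw [h])

/-- If `w ∘ x` is a fundamental sequence of period `m n`, then `x` is one of period `n`. -/
theorem IsFundamentalSeq.of_seqComp (hw : IsFundamentalSeq M m w) {x : ℕ → ℕ} (hx0 : x 0 = 1)
    (hx : ∀ i, x i ≤ 1) {n : ℕ} (hs : IsFundamentalSeq M (m * n) (seqComp M m w 0 x)) :
    IsFundamentalSeq 1 n x := by
  have hm := hw.pos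
  have hn : 1 ≤ n := by
    by_contra! hc
    obtain rfl : n = 0 := by omega
    have := hs.pos
    omega
  -- Otherwise the block opening the second period would be read after 1 and start with a digit
  -- smaller than the first digit of `w⁺`.
  have hxlast : x (n - 1) = 0 := by
    by_contra hne
    have h1 := hs.periodic 0
    rw [show 0 + m * n = m * n + 0 by ring, seqComp_mul_add _ _ _ hm, if_neg (by omega)] at h1
    have h2 := seqComp_mul_add (M := M) (s := w) 0 x 0 hm
    rw [mul_zero, zero_add] at h2
    have h3 := hw.refl_lt_plusDigit
    have h4 : w 0 ≤ plusDigit m w 0 := by unfold plusDigit; split_ifs <;> omega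
    rw [h2] at h1
    simp only [compBlock, if_neg hne, hx0] at h1
    simp at h1
    split_ifs at h1 <;> omega
  have hshift : ∀ i, 1 ≤ i → shiftSeq (m * i) (seqComp M m w 0 x) =
      seqComp M m w (x (i - 1)) (shiftSeq i x) := by
    intro i hi
    obtain ⟨k, rfl⟩ := Nat.exists_eq_add_of_le' hi
    exact shiftSeq_seqComp hm 0 x k
  have hxs : ∀ k i, shiftSeq k x i ≤ 1 := fun k i => hx _
  have hxr : ∀ i, reflSeq 1 x i ≤ 1 := fun i => Nat.sub_le _ _
  have hper : ∀ i, x (i + n) = x i := by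
    have h1 : shiftSeq (m * n) (seqComp M m w 0 x) = seqComp M m w 0 x := by
      funext i
      rw [shiftSeq, add_comm, hs.periodic]
    rw [hshift n hn, hxlast] at h1
    intro i
    have := congrFun (seqComp_injective hw 0 (hxs n) hx h1) i
    rwa [shiftSeq, add_comm] at this
  have hfirst : ∃ r, x r = 0 ∧ ∀ j < r, x j = 1 := by
    have hex : ∃ r, x r = 0 := ⟨n - 1, hxlast⟩
    refine ⟨Nat.find hex, Nat.find_spec hex, fun j hj => ?_⟩
    have := Nat.find_min hex hj
    have := hx j
    omega
  obtain ⟨r, hr0, hr1⟩ := hfirst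
  refine .of_toLex hn hx hper ?_ ?_ (fun h => by subst h; simp at hxlast; omega)
  · intro i
    induction i with
    | zero => omega
    | succ k ih =>
      intro _ hkn
      obtain h | h : x k = 0 ∨ x k = 1 := by have := hx k; omega
      · have h1 := hs.toLex_shiftSeq_lt (i := m * (k + 1)) (Nat.mul_pos hm (by omega))
          (Nat.mul_lt_mul_of_pos_left hkn hm)
        rw [hshift (k + 1) (by omega), Nat.add_sub_cancel, h] at h1
        exact (toLex_seqComp_lt_iff hw 0 (hxs _) hx).1 h1
      -- After a 1 the block inequality cannot be pulled back directly. But if the shift by `k + 1`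
      -- were at least `x`, the preceding 1 would put the shift by `k` above `x`, against the
      -- induction hypothesis.
      · by_contra! hc
        have h1 := toLex_lt_of_le_shiftSeq_one (g := shiftSeq k x) (hxs k) h
          (by rw [shiftSeq_shiftSeq]; exact not_lt.1 hc) hr1 hr0
        rcases Nat.eq_zero_or_pos k with rfl | hk
        · rw [shiftSeq_zero] at h1
          exact absurd h1 (lt_irrefl _)
        · exact absurd h1 (ih hk (by omega)).not_gt
  · intro i
    induction i with
    | zero =>
      rw [shiftSeq_zero]
      exact (toLex_lt_iff.2 ⟨0, by simp, by simp [reflSeq, hx0]⟩).le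
    | succ k ih =>
      obtain h | h : x k = 1 ∨ x k = 0 := by have := hx k; omega
      · have h1 := hs.toLex_reflSeq_le (m * (k + 1))
        rw [hshift (k + 1) (by omega), Nat.add_sub_cancel, h,
          reflSeq_seqComp hw (by norm_num) hx] at h1
        exact (toLex_seqComp_le_iff hw 1 hxr (hxs _)).1 h1
      · by_contra! hc
        have h1 := toLex_reflSeq_le_reflSeq (hxs _) hxr hc.le
        rw [reflSeq_reflSeq hx] at h1
        have h2 := toLex_lt_of_le_shiftSeq_one (f := x) (g := reflSeq 1 (shiftSeq k x))
          (fun i => Nat.sub_le _ _) (by simp [reflSeq, shiftSeq, h])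
          (by
            convert h1 using 2
            funext i
            simp only [shiftSeq, reflSeq, add_assoc]) hr1 hr0
        have h3 := toLex_reflSeq_le_reflSeq hxr (hxs _) ih
        rw [reflSeq_reflSeq hx] at h3
        exact absurd h2 h3.not_gt

end Parse

/-! ### Fundamental words below the right endpoint of `J_u` -/

section Unit

variable {M : ℕ} {a : List ℕ}

theorem eq_of_wordPeriodic_eq {a b : List ℕ} (hlen : a.length = b.length)
    (h : wordPeriodic a = wordPeriodic b) : a = b := by
  rw [list_eq_iff hlen]
  intro j hj
  rw [← wordPeriodic_of_lt hj, ← wordPeriodic_of_lt (hlen ▸ hj), h]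

theorem wordPeriodic_range_map {n : ℕ} (hn : 1 ≤ n) {x : ℕ → ℕ} (hx : ∀ i, x (i + n) = x i) :
    wordPeriodic ((List.range n).map x) = x := by
  have hlen : ((List.range n).map x).length = n := by simp
  refine eq_of_periodic hn (fun i => ?_) hx (fun i hi => ?_)
  · have := wordPeriodic_add ((List.range n).map x) i
    rwa [hlen] at this
  · rw [wordPeriodic_of_lt (by omega)]
    simp [hi]

/-- A fundamental word whose periodic sequence decomposes into the blocks of a fundamental word `w`
is a composition with `w`. -/
theorem exists_eq_wordComp {w : List ℕ} (hw : IsFundamental M w) (ha : IsFundamental M a)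
    {x : ℕ → ℕ} (hx0 : x 0 = 1) (hx : ∀ i, x i ≤ 1)
    (hax : wordPeriodic a = seqComp M w.length (wordPeriodic w) 0 x)
    (hdvd : w.length ∣ a.length) : ∃ b, IsFundamental 1 b ∧ a = wordComp M w b := by
  obtain ⟨n, hn⟩ := hdvd
  have h1 := isFundamental_iff.1 ha
  rw [hn, hax] at h1
  have h2 := (isFundamental_iff.1 hw).of_seqComp hx0 hx h1
  have h3 := wordPeriodic_range_map h2.pos h2.periodic
  have hb : IsFundamental 1 ((List.range n).map x) := by
    rw [isFundamental_iff, h3]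
    simpa using h2
  refine ⟨_, hb, eq_of_wordPeriodic_eq ?_ ?_⟩
  · rw [length_wordComp hw.length_pos, hn]; simp
  · have := seqL_wordComp (M := M) hw.length_pos hb
    rw [seqL, seqL, h3] at this
    rw [this, hax]

theorem compBlock_unitLift_odd {k p d l : ℕ} (hp : p ≤ 1) (hd : d ≤ 1) (hl : l < 2) :
    compBlock (2 * k + 1) 2 (wordPeriodic [k + 1, k]) p d l =
      if l = 0 then k + 1 - p else k + d := by
  have h0 : wordPeriodic [k + 1, k] 0 = k + 1 := by simp [wordPeriodic_apply]
  have h1 : wordPeriodic [k + 1, k] 1 = k := by simp [wordPeriodic_apply]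
  obtain rfl | rfl : p = 0 ∨ p = 1 := by omega
  all_goals obtain rfl | rfl : d = 0 ∨ d = 1 := by omega
  all_goals obtain rfl | rfl : l = 0 ∨ l = 1 := by omega
  all_goals simp [compBlock, plusDigit, h0, h1]
  all_goals omega

theorem unitLift_even (k : ℕ) : unitLift (k + k) = [k] := by
  rw [unitLift, if_pos ⟨k, rfl⟩, show (k + k) / 2 = k by omega]

theorem unitLift_odd (k : ℕ) : unitLift (2 * k + 1) = [k + 1, k] := by
  rw [unitLift, if_neg (by simp), show (2 * k + 1) / 2 = k by omega]

/-- The first digits of a fundamental sequence below `u⁺ (ū)^∞`. -/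
theorem eq_unitLift_or_prefix (ha : IsFundamental M a)
    (hle : toLex (seqL a) ≤ toLex (seqR M (unitLift M))) :
    a = unitLift M ∨ ∀ l < (unitLift M).length, seqL a l = seqR M (unitLift M) l := by
  have hs := isFundamental_iff.1 ha
  have hbd : ∀ i, M - wordPeriodic a 0 ≤ wordPeriodic a i ∧ wordPeriodic a i ≤ wordPeriodic a 0 :=
    fun i => ⟨hs.refl_le_zero i, by simpa [shiftSeq] using toLex_head_le (hs.toLex_shiftSeq_le i)⟩
  have hhead := toLex_head_le hle
  have hz := hs.refl_zero_le
  rcases Nat.even_or_odd M with ⟨k, rfl⟩ | ⟨k, rfl⟩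
  · rw [unitLift_even] at *
    have hR : seqR (k + k) [k] 0 = k + 1 := by
      rw [seqR_of_lt (by simp)]; simp [wordPeriodic_apply]
    rw [hR] at hhead
    simp only [seqL] at *
    rcases hhead.lt_or_eq with h | h
    · left
      have hconst : ∀ i, wordPeriodic a i = k := fun i => by have := hbd i; omega
      have hlen : a.length = 1 := by
        by_contra hne
        have := hs.pos
        obtain ⟨j, -, -, hj⟩ := hs.shift_lt 1 le_rfl (by omega)
        rw [hconst, hconst] at hj
        exact lt_irrefl _ hj
      refine eq_of_wordPeriodic_eq hlen (funext fun i => ?_)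
      rw [hconst, wordPeriodic_apply]
      simp [Nat.mod_one]
    · right
      intro l hl
      obtain rfl : l = 0 := by simpa using hl
      rw [h, hR]
  · rw [unitLift_odd] at *
    have hR0 : seqR (2 * k + 1) [k + 1, k] 0 = k + 1 := by
      rw [seqR_of_lt (by simp)]; simp [wordPeriodic_apply]
    have hR1 : seqR (2 * k + 1) [k + 1, k] 1 = k + 1 := by
      rw [seqR_of_lt (by simp)]; simp [wordPeriodic_apply]
    rw [hR0] at hhead
    simp only [seqL] at *
    have h0 : wordPeriodic a 0 = k + 1 := by omega
    rw [h0] at hbd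
    by_cases h1 : wordPeriodic a 1 = k + 1
    · right
      intro l hl
      obtain rfl | rfl : l = 0 ∨ l = 1 := by simp at hl; omega
      · rw [h0, hR0]
      · rw [h1, hR1]
    · left
      have h1 : wordPeriodic a 1 = k := by have := hbd 1; omega
      have hstep : ∀ i, wordPeriodic a (i + 2) = wordPeriodic a i := by
        -- Only the digits `k` and `k + 1` occur. Repeating `k + 1` would exceed the initial `(k+1)
        -- k`, and repeating `k` would fall below its reflection.
        have hflip : ∀ i, wordPeriodic a (i + 1) + wordPeriodic a i = 2 * k + 1 := by
          intro i
          have h2 := hbd i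
          have h3 := hbd (i + 1)
          obtain h | h : wordPeriodic a i = k + 1 ∨ wordPeriodic a i = k := by omega
          · by_contra hne
            refine (hs.toLex_shiftSeq_le i).not_gt (toLex_lt_iff.2 ⟨1, fun j hj => ?_, ?_⟩)
            · obtain rfl : j = 0 := by omega
              simp [shiftSeq, h0, h]
            · simp only [shiftSeq]; omega
          · by_contra hne
            refine (hs.toLex_reflSeq_le i).not_gt (toLex_lt_iff.2 ⟨1, fun j hj => ?_, ?_⟩)
            · obtain rfl : j = 0 := by omega
              simp only [shiftSeq, reflSeq, add_zero, h0, h]; omega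
            · simp only [shiftSeq, reflSeq]; omega
        intro i
        have := hflip i
        have := hflip (i + 1)
        rw [add_assoc] at this
        simp at this
        omega
      have hlen : a.length = 2 := by
        by_contra hne
        have hpos := hs.pos
        rcases hpos.lt_or_eq with h | h
        · obtain ⟨j, -, -, hj⟩ := hs.shift_lt 2 (by norm_num) (by omega)
          rw [add_comm, hstep] at hj
          exact lt_irrefl _ hj
        · have := hs.periodic 0
          rw [← h, zero_add] at this
          omega
      refine eq_of_wordPeriodic_eq hlen (eq_of_periodic (P := 2) (by norm_num) hstep
        (wordPeriodic_add [k + 1, k]) (fun i hi => ?_))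
      obtain rfl | rfl : i = 0 ∨ i = 1 := by omega
      · rw [h0]; simp [wordPeriodic_apply]
      · rw [h1]; simp [wordPeriodic_apply]

/-- A fundamental word whose interval starts at or before the right endpoint of `J_u` is either `u`
or a composition with `u`. -/
theorem eq_unitLift_or_exists_wordComp (hM : 1 ≤ M) (ha : IsFundamental M a)
    (hle : toLex (seqL a) ≤ toLex (seqR M (unitLift M))) :
    a = unitLift M ∨ ∃ b, IsFundamental 1 b ∧ a = wordComp M (unitLift M) b := by
  rcases eq_unitLift_or_prefix ha hle with h | hpre
  · exact Or.inl h
  right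
  have hu := isFundamental_unitLift hM
  have hw := isFundamental_iff.1 hu
  have hs := isFundamental_iff.1 ha
  have hR := seqR_eq_seqComp (M := M) hu.length_pos
  have hRle := hu.isAdmissibleSeq_seqR.1
  have hU : ∀ i, toLex (shiftSeq i (seqL a)) ≤ toLex (seqR M (unitLift M)) :=
    fun i => (hs.toLex_shiftSeq_le i).trans hle
  have hL : ∀ i, toLex (reflSeq M (seqR M (unitLift M))) ≤ toLex (shiftSeq i (seqL a)) :=
    fun i => (toLex_reflSeq_le_reflSeq hs.le hRle hle).trans (hs.toLex_reflSeq_le i)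
  rw [hR] at hU hL hpre
  obtain ⟨x, hx0, hx, hax⟩ := exists_eq_seqComp hw hs.le hU hL hpre
  refine exists_eq_wordComp hu ha hx0 hx hax ?_
  rcases Nat.even_or_odd M with ⟨k, rfl⟩ | ⟨k, rfl⟩
  · rw [unitLift_even]; exact one_dvd _
  · rw [unitLift_odd] at *
    -- For odd length `2j + 1`, comparing the first two digits of the second period with those of
    -- the first gives both `x j = 1` and `x j = 0`.
    by_contra hodd
    obtain ⟨j, hj⟩ : ∃ j, a.length = 2 * j + 1 := by
      have : ¬ 2 ∣ a.length := hodd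
      exact ⟨a.length / 2, by omega⟩
    have hval : ∀ i l, l < 2 → wordPeriodic a (2 * i + l) =
        if l = 0 then k + 1 - (if i = 0 then 0 else x (i - 1)) else k + x i := by
      intro i l hl
      have := congrFun hax (2 * i + l)
      simp only [List.length_cons, List.length_nil] at this
      rw [this]
      refine (seqComp_mul_add 0 x i hl).trans (compBlock_unitLift_odd ?_ (hx i) hl)
      split_ifs <;> simp [hx]
    have h1 := hs.periodic 0
    have h2 := hs.periodic 1
    rw [hj, show 0 + (2 * j + 1) = 2 * j + 1 by ring, hval j 1 (by norm_num)] at h1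
    rw [hj, show 1 + (2 * j + 1) = 2 * (j + 1) + 0 by ring, hval (j + 1) 0 (by norm_num)] at h2
    have h3 := hval 0 0 (by norm_num)
    have h4 := hval 0 1 (by norm_num)
    simp [hx0] at h1 h2 h3 h4
    omega

theorem IsIrreducibleWord.seqR_unitLift_lt (hM : 1 ≤ M) (ha : IsIrreducibleWord M a)
    (hne : a ≠ unitLift M) : toLex (seqR M (unitLift M)) < toLex (seqL a) := by
  by_contra! hc
  rcases eq_unitLift_or_exists_wordComp hM ha.1 (not_lt.1 hc) with h | ⟨b, hb, h⟩
  · exact hne h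
  · exact ha.2 ⟨_, b, isFundamental_unitLift hM, hb, h⟩

/-- Binary fundamental words have length at least 2, so a decomposition of `u` requires `M` odd and
`c` a single digit. Then `c⁺` is the digit `k + 1`, so `c` is `k`, violating `M - c ≤ c`. -/
theorem isIrreducibleWord_unitLift (hM : 1 ≤ M) : IsIrreducibleWord M (unitLift M) := by
  refine ⟨isFundamental_unitLift hM, ?_⟩
  rintro ⟨c, d, hc, hd, h⟩
  have hlen := length_wordComp (M := M) (b := d) hc.length_pos
  have hcpos := hc.length_pos
  have hdpos : 2 ≤ d.length := by
    by_contra! hlt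
    have := hd.length_pos
    have h1 := hd.digits
    rw [show d.length - 1 = 0 by omega] at h1
    omega
  rw [← h] at hlen
  have h2 := Nat.mul_le_mul hcpos hdpos
  rcases Nat.even_or_odd M with ⟨k, rfl⟩ | ⟨k, rfl⟩
  · rw [unitLift_even] at *
    simp at hlen
    omega
  · rw [unitLift_odd] at *
    simp only [List.length_cons, List.length_nil] at hlen
    have hc1 : c.length = 1 := by
      by_contra hne
      have := Nat.mul_le_mul (show 2 ≤ c.length by omega) hdpos
      omega
    have h3 := congrFun (seqL_wordComp (M := 2 * k + 1) hcpos hd) (c.length * 0 + 0)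
    rw [seqComp_mul_add _ _ _ hcpos, ← h, hc1] at h3
    have h4 := hd.digits.1
    have h5 := (isFundamental_iff.1 hc).refl_zero_le
    simp [seqL, h4, compBlock, plusDigit] at h3
    simp [wordPeriodic_apply [k + 1, k]] at h3
    omega

theorem unitLift_one : unitLift 1 = [1, 0] := unitLift_odd 0

end Unit

/-! ### Location of the irreducible and `n`-irreducible intervals -/

theorem proposition3p3 (M : ℕ) (hM : 1 ≤ M) :
    -- all the bases in question are well defined
    ((∃! q, IsBaseOf M (seqG M) q) ∧
      (∀ n, 1 ≤ n → ∃! q, IsBaseOf M (seqPrime M n) q) ∧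
      (∀ a, IsFundamental M a →
        (∃! q, IsBaseOf M (seqL a) q) ∧ (∃! q, IsBaseOf M (seqR M a) q) ∧ qL M a < qR M a)) ∧
    -- irreducible intervals
    (IsIrreducibleInterval M (qG M) (qT M) ∧
      ¬ Icc (qG M) (qT M) ⊆ intervalI M 0 ∧
      ∀ p r, IsIrreducibleInterval M p r → (p, r) ≠ (qG M, qT M) →
        Icc p r ⊆ intervalI M 0) ∧
    -- `n`-irreducible intervals
    (∀ n, 1 ≤ n →
      (∃! p, IsNIrreducibleInterval M n p (qPrime M (n + 1))) ∧
      (∀ p, IsNIrreducibleInterval M n p (qPrime M (n + 1)) →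
        ¬ Icc p (qPrime M (n + 1)) ⊆ intervalI M n) ∧
      ∀ p r, IsNIrreducibleInterval M n p r → r ≠ qPrime M (n + 1) →
        Icc p r ⊆ intervalI M n) := by
  have hu := isFundamental_unitLift hM
  have hlt : ∀ a, IsFundamental M a → qL M a < qR M a := fun a ha =>
    ha.isAdmissibleSeq_seqL.baseOf_lt ha.isAdmissibleSeq_seqR ha.seqL_lt_seqR
  have hG : qG M = qL M (unitLift M) := by rw [qG, seqG_eq, qL]
  have hprime : ∀ n, qPrime M (n + 1) = qR M (unitLiftTenPow M n) := fun n => by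
    rw [qPrime, if_neg (by omega), seqPrime_succ hM, qR]
  have hT : qT M = qR M (unitLift M) := hprime 0
  refine ⟨⟨?_, fun n hn => ?_, fun a ha => ⟨ha.isAdmissibleSeq_seqL.existsUnique_base,
    ha.isAdmissibleSeq_seqR.existsUnique_base, hlt a ha⟩⟩, ⟨?_, fun hsub => ?_, ?_⟩, fun n hn => ?_⟩
  · rw [seqG_eq]
    exact hu.isAdmissibleSeq_seqL.existsUnique_base
  · obtain ⟨n, rfl⟩ := Nat.exists_eq_add_of_le' hn
    rw [seqPrime_succ hM]
    exact (isFundamental_unitLiftTenPow hM n).isAdmissibleSeq_seqR.existsUnique_base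
  · exact ⟨_, isIrreducibleWord_unitLift hM, hG, hT⟩
  · refine (lt_irrefl (qT M)) (hsub (right_mem_Icc.2 ?_)).1
    rw [hG, hT]
    exact (hlt _ hu).le
  · rintro p r ⟨a, ha, rfl, rfl⟩ hne x hx
    have hau : a ≠ unitLift M := by
      rintro rfl
      exact hne (by rw [hG, hT])
    have h1 := hu.isAdmissibleSeq_seqR.baseOf_lt ha.1.isAdmissibleSeq_seqL
      (ha.seqR_unitLift_lt hM hau)
    refine ⟨?_, ?_⟩
    · exact (hprime 0).trans_lt (h1.trans_le hx.1)
    · rw [qPrime, if_pos rfl]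
      exact hx.2.trans ha.1.isAdmissibleSeq_seqR.isBaseOf_baseOf.1.2
  · obtain ⟨n, rfl⟩ := Nat.exists_eq_add_of_le' hn
    have hw := isFundamental_unitLiftTenPow hM n
    have hw' := isFundamental_unitLiftTenPow hM (n + 1)
    have hten : IsIrreducibleWord 1 [1, 0] := unitLift_one ▸ isIrreducibleWord_unitLift le_rfl
    have hword : unitLiftTenPow M (n + 1) = wordComp M (unitLiftTenPow M n) [1, 0] := rfl
    have hgt : ∀ b, IsIrreducibleWord 1 b → b ≠ [1, 0] →
        IsFundamental M (wordComp M (unitLiftTenPow M n) b) →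
        qPrime M (n + 1 + 1) < qL M (wordComp M (unitLiftTenPow M n) b) := by
      intro b hb hne hcomp
      rw [hprime]
      refine hw'.isAdmissibleSeq_seqR.baseOf_lt hcomp.isAdmissibleSeq_seqL ?_
      rw [hword, seqR_wordComp hw hten.1, seqL_wordComp hw.length_pos hb.1]
      -- Monotonicity of composition reduces the claim to the binary alphabet, where `10` is the
      -- unit lift and the result on irreducible words applies to `b`.
      refine toLex_seqComp_lt (isFundamental_iff.1 hw) 0 hb.1.isAdmissibleSeq_seqL.1 ?_
      have := hb.seqR_unitLift_lt le_rfl (by rwa [unitLift_one])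
      rwa [unitLift_one] at this
    have hr : ∀ a b, IsIrreducibleWord 1 b → IsFundamental M a →
        a = wordComp M (unitLiftTenPow M n) b → qPrime M (n + 1 + 1) = qR M a → b = [1, 0] := by
      rintro a b hb ha rfl heq
      by_contra hne
      exact absurd ((hgt b hb hne ha).trans (hlt _ ha)) (by rw [heq]; exact lt_irrefl _)
    refine ⟨⟨qL M (unitLiftTenPow M (n + 1)), ⟨_, ⟨hw', _, hten, rfl⟩, rfl, hprime _⟩, ?_⟩, ?_, ?_⟩
    · rintro p ⟨a, ⟨ha, b, hb, hab⟩, rfl, hra⟩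
      rw [Nat.add_sub_cancel] at hab
      obtain rfl := hr a b hb ha hab hra
      rw [hab, hword]
    · rintro p ⟨a, ⟨ha, -⟩, rfl, hra⟩ hsub
      refine (lt_irrefl (qPrime M (n + 1 + 1))) (hsub (right_mem_Icc.2 ?_)).1
      rw [hra]
      exact (hlt _ ha).le
    · rintro p r ⟨a, ⟨ha, b, hb, hab⟩, rfl, rfl⟩ hne x hx
      rw [Nat.add_sub_cancel] at hab
      subst hab
      have hb10 : b ≠ [1, 0] := by
        rintro rfl
        exact hne (hprime (n + 1)).symm
      refine ⟨(hgt b hb hb10 ha).trans_le hx.1, hx.2.trans ?_⟩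
      rw [hprime n]
      refine ha.isAdmissibleSeq_seqR.baseOf_le hw.isAdmissibleSeq_seqR ?_
      -- The base `q'_n` corresponds to composing with `1^∞`, the largest binary sequence.
      rw [seqR_wordComp hw hb.1, seqR_eq_seqComp hw.length_pos]
      exact (toLex_seqComp_le_iff (isFundamental_iff.1 hw) 0 (seqR_le_one hb.1)
        (fun _ => le_rfl)).2 (toLex_le_const_one (seqR_le_one hb.1))
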